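/- **Theorem (density-matrix-exponentiation approach to the Procrustes problem).** Let $|\psi_i\rangle,|\phi_i\rangle$ ($0\le i<r$, $r\ge 1$) be pure states of $n$ qubits, and let $U_\psi,U_\phi$ be unitaries with $U_\psi|i\rangle|0\rangle=|i\rangle|\psi_i\rangle$ and $U_\phi|i\rangle|0\rangle=|i\rangle|\phi_i\rangle$ for all $i$, where $|i\rangle$ is a basis state of an $r$-dimensional index register. Let $cU_\psi,cU_\phi$ be their controlled versions. Put $A=\sum_i|\phi_i\rangle\langle\psi_i|$, with singular value decomposition $A=\sum_j\sigma_j|w_j\rangle\langle v_j|$ ($\sigma_j>0$, $(v_j)$ and $(w_j)$ orthonormal), let $U_{\rm Procrustes}=\sum_j|w_j\rangle\langle v_j|$ be its polar isometry, let $\sigma_{\min}(A)=\min_j\sigma_j$, and let $\Pi$ be the orthogonal projector onto $\operatorname{span}\{|\psi_i\rangle\}$. Assume that this span is the row space $\operatorname{span}\{|v_j\rangle\}$ of $A$. For an $n$-qubit state $|\psi\rangle$ with $\Pi|\psi\rangle\neq0$ put $$|\psi_{\rm ideal}\rangle=\frac{1}{\lVert\Pi|\psi\rangle\rVert_2}\,U_{\rm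 Procrustes}|\psi\rangle .$$ There are absolute constants $C>0$ and $k\in\mathbb N$ such that for all $n$, $r\ge1$, $\kappa>0$, $c>0$, $\varepsilon>0$ there is a quantum circuit, depending only on these parameters, that consists of fixed unitaries, uses of $cU_\psi$, $cU_\phi$ and their adjoints, and uses of a unitary $U_{\rm in}$ with $U_{\rm in}|0\rangle=|\psi\rangle$ and of its adjoint, such that 1. each of $cU_\psi,\ cU_\psi^\dagger,\ cU_\phi,\ cU_\phi^\dagger$ is used at most $$C\,\frac{r^2\kappa^2}{c^{3/2}\varepsilon^3}\,\log^k\!\Big(2+\frac{r\kappa}{c\,\varepsilon}\Big)=\tilde O\!\Big(\frac{r^2\kappa^2}{c^{3/2}\varepsilon^3}\Big)$$ times, and 2. for all $|\psi_i\rangle,|\phi_i\rangle,U_\psi,U_\phi$ as above with $1/\sigma_{\min}(A)\le\kappa$ and every input state $|\psi\rangle$ (prepared by any such $U_{\rm in}$) with $\lVert\Pi|\psi\rangle\rVert_2>c$, the circuit, started in the all-zero state, outputs a state $|\psi_{\rm out}\rangle$ with $$\big\lVert\,|\psi_{\rm out}\rangle-|\bar0\rangle|\psi_{\rm ideal}\rangle\,\big\rVert_2\le\varepsilon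 .$$ -/

import Mathlib

open scoped Kronecker Matrix

namespace Procrustes

noncomputable section

/-- State vectors with amplitudes indexed by `ι`, with the Euclidean norm. -/
abbrev Vec (ι : Type) [Fintype ι] : Type := EuclideanSpace ℂ ι

/-- The computational basis vector `|i⟩`. -/
def ket {ι : Type} [Fintype ι] [DecidableEq ι] (i : ι) : Vec ι :=
  EuclideanSpace.single i 1

/-- The tensor product `x ⊗ y` of two state vectors. -/
def tensor {ι μ : Type} [Fintype ι] [Fintype μ] (x : Vec ι) (y : Vec μ) : Vec (ι × μ) :=
  WithLp.toLp 2 fun p => x p.1 * y p.2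

/-- The action of a matrix on a state vector. -/
def act {ι μ : Type} [Fintype ι] [Fintype μ] (M : Matrix ι μ ℂ) (x : Vec μ) : Vec ι :=
  WithLp.toLp 2 (M *ᵥ x.ofLp)

/-- The rank-one matrix `|x⟩⟨y|`. -/
def outer {ι μ : Type} [Fintype ι] [Fintype μ] (x : Vec ι) (y : Vec μ) : Matrix ι μ ℂ :=
  Matrix.of fun i j => x i * star (y j)

/-! ### Singular value decomposition and polar isometry -/

/-- A (reduced) singular value decomposition `A = ∑ i, σ i |w i⟩⟨v i|`, with positive
singular values and orthonormal families of singular vectors. -/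
structure SVD {N : ℕ} (A : Matrix (Fin N) (Fin N) ℂ) where
  rank : ℕ
  σ : Fin rank → ℝ
  v : Fin rank → Vec (Fin N)
  w : Fin rank → Vec (Fin N)
  σ_pos : ∀ i, 0 < σ i
  v_orthonormal : Orthonormal ℂ v
  w_orthonormal : Orthonormal ℂ w
  eq_sum : A = ∑ i, (σ i : ℂ) • outer (w i) (v i)

namespace SVD

variable {N : ℕ} {A : Matrix (Fin N) (Fin N) ℂ}

/-- The polar decomposition isometry `W V†`. -/
def polar (S : SVD A) : Matrix (Fin N) (Fin N) ℂ :=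
  ∑ i, outer (S.w i) (S.v i)

/-- The row space of `A`, spanned by the right singular vectors. -/
def row (S : SVD A) : Submodule ℂ (Vec (Fin N)) :=
  Submodule.span ℂ (Set.range S.v)

/-- The smallest nonzero singular value of `A`. -/
def sigmaMin (S : SVD A) : ℝ :=
  ⨅ i, S.σ i

end SVD

/-! ### The Procrustes problem -/

/-- `A = G F† = ∑ i, |φ i⟩⟨ψ i|`, where the columns of `F`, `G` are the `ψ i`, `φ i`. -/
def procrustesMatrix {r N : ℕ} (ψ φ : Fin r → Vec (Fin N)) : Matrix (Fin N) (Fin N) ℂ :=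
  ∑ i, outer (φ i) (ψ i)

/-- The norm of the orthogonal projection of `x` onto the span of the input states `ψ i`. -/
def overlap {r N : ℕ} (ψ : Fin r → Vec (Fin N)) (x : Vec (Fin N)) : ℝ :=
  ‖(Submodule.span ℂ (Set.range ψ)).starProjection x‖

/-- The ideal output `U_Procrustes |x⟩ / ‖Π |x⟩‖`, with `Π` the projector onto the span of the
input states. -/
def idealState {r N : ℕ} {ψ φ : Fin r → Vec (Fin N)} (S : SVD (procrustesMatrix ψ φ))
    (x : Vec (Fin N)) : Vec (Fin N) :=
  ((1 / overlap ψ x : ℝ) : ℂ) • act S.polar x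

/-- `U |i⟩|0⟩ = |i⟩|ψ i⟩` for all `i`; `U` is arbitrary on the other basis vectors. -/
def IsStatePreparation {r n : ℕ} (U : Matrix.unitaryGroup (Fin r × Fin (2 ^ n)) ℂ)
    (ψ : Fin r → Vec (Fin (2 ^ n))) : Prop :=
  ∀ i, act (U : Matrix (Fin r × Fin (2 ^ n)) (Fin r × Fin (2 ^ n)) ℂ) (ket (i, 0)) =
    tensor (ket i) (ψ i)

/-! ### Oracle circuits -/

/-- Computational basis of the workspace: a control qubit, an index register of dimension `r`
(that is, `log₂ r` qubits if `r` is a power of two), an `n`-qubit register, and `a` further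
ancilla qubits. -/
abbrev Work (r n a : ℕ) : Type := (Fin 2 × (Fin r × Fin (2 ^ n))) × Fin (2 ^ a)

/-- The oracles whose uses are counted: `cU_ψ`, `cU_ψ†`, `cU_φ`, `cU_φ†`. -/
inductive Query : Type
  | psi
  | psiAdj
  | phi
  | phiAdj
  deriving DecidableEq

/-- An elementary step of a circuit: a fixed unitary on the workspace, a use of one of the
controlled state preparations, or a use of the preparation `U_in` of the input state or of its
adjoint. Fixed unitaries include all permutations of the registers, so it is no restriction that
the oracles act on fixed registers. -/
inductive Gate (r n a : ℕ) : Type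
  | fixed (V : Matrix.unitaryGroup (Work r n a) ℂ)
  | query (q : Query)
  | input
  | inputAdj

/-- A circuit is a list of gates, the first gate being applied first. -/
abbrev Circuit (r n a : ℕ) : Type := List (Gate r n a)

/-- The controlled operation `|0⟩⟨0| ⊗ 1 + |1⟩⟨1| ⊗ U`. -/
def controlled {ι : Type} [Fintype ι] [DecidableEq ι] (U : Matrix ι ι ℂ) :
    Matrix (Fin 2 × ι) (Fin 2 × ι) ℂ :=
  Matrix.single 0 0 1 ⊗ₖ (1 : Matrix ι ι ℂ) + Matrix.single 1 1 1 ⊗ₖ U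

section

variable {r n a : ℕ} (Uψ Uφ : Matrix.unitaryGroup (Fin r × Fin (2 ^ n)) ℂ)
  (Uin : Matrix.unitaryGroup (Fin (2 ^ n)) ℂ)

/-- The operation performed by a query, before padding with ancillas. -/
def Query.mat : Query → Matrix (Fin 2 × (Fin r × Fin (2 ^ n))) (Fin 2 × (Fin r × Fin (2 ^ n))) ℂ
  | .psi => controlled (Uψ : Matrix _ _ ℂ)
  | .psiAdj => (controlled (Uψ : Matrix _ _ ℂ))ᴴ
  | .phi => controlled (Uφ : Matrix _ _ ℂ)
  | .phiAdj => (controlled (Uφ : Matrix _ _ ℂ))ᴴ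

/-- The action of a gate on the workspace, given the oracles. -/
def Gate.mat : Gate r n a → Matrix (Work r n a) (Work r n a) ℂ
  | .fixed V => V
  | .query q => q.mat Uψ Uφ ⊗ₖ 1
  | .input => (1 ⊗ₖ (1 ⊗ₖ (Uin : Matrix _ _ ℂ))) ⊗ₖ 1
  | .inputAdj => (1 ⊗ₖ (1 ⊗ₖ (Uin : Matrix _ _ ℂ)ᴴ)) ⊗ₖ 1

/-- The vector obtained by running a circuit, given the oracles, on the initial vector `x`. -/
def Circuit.run (circ : Circuit r n a) (x : Vec (Work r n a)) : Vec (Work r n a) :=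
  circ.foldl (fun y g => act (g.mat Uψ Uφ Uin) y) x

end

/-- Whether a gate is a use of the oracle `q`. -/
def Gate.isQuery {r n a : ℕ} (q : Query) : Gate r n a → Bool
  | .query q' => decide (q' = q)
  | _ => false

/-- The number of uses of the oracle `q` in a circuit. -/
def Circuit.uses {r n a : ℕ} (q : Query) (circ : Circuit r n a) : ℕ :=
  circ.countP (Gate.isQuery q)

/-- The vector `|0̄⟩|x⟩`: the `n`-qubit register holds `x`, all other registers hold `|0⟩`. -/
def padded {r n : ℕ} [NeZero r] (a : ℕ) (x : Vec (Fin (2 ^ n))) : Vec (Work r n a) :=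
  tensor (tensor (ket 0) (tensor (ket 0) x)) (ket 0)

/-- The output vector of a circuit that is started in the all-zero state. -/
def Circuit.output {r n a : ℕ} [NeZero r] (circ : Circuit r n a)
    (Uψ Uφ : Matrix.unitaryGroup (Fin r × Fin (2 ^ n)) ℂ)
    (Uin : Matrix.unitaryGroup (Fin (2 ^ n)) ℂ) : Vec (Work r n a) :=
  Circuit.run Uψ Uφ Uin circ (padded a (ket 0))

end

end Procrustes

namespace Procrustes
noncomputable section

/-! ### Amplitude amplification on a pair of subspaces -/

section Amplification

variable {E : Type*} [NormedAddCommGroup E] [InnerProductSpace ℂ E]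

/-! The proof transforms singular values by amplitude amplification; density matrix exponentiation
is not needed. Write R = rκ. The controlled preparations yield a unitary whose compression to a code
space is A/r: the average of 1 and a reflection is the projector between `U_φ` and `U_ψ†`
(`starProjection_blockEncoding`). Amplification by j steps turns a singular value sin θ of a
compression into sin((2j+1)θ) (`IsSingularPair.proj_grover_pow`), and a register in a superposition
of step numbers averages these sines. With weights 1/(2j+1), the average is a partial sum of the
Fourier series of the square wave, divided by the total weight Λ = O(log M). On (0, π/2] the partial
sum of M terms is π/4 up to O(1/(M sin θ)) (`abs_squareWave_sub_le`).

This device is used twice. The nonzero singular values of A/r are at least 1/R, so M₁ = O(R/ε) terms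
send all of them close to π/(4Λ₁): the compression becomes nearly a multiple of the polar isometry
(`SVD.exists_starProjection_eq`). On the input state, the target component is then nearly parallel
to the ideal state, with an unknown amplitude of order at least c/Λ₁. That preparation is itself a
compression with one singular value, so M₂ = O(Λ₁/(cε)) terms make its amplitude nearly independent
of the input. A factor ρ tunes the amplitude to sin(π/(2(2m+1))) with m = ⌈Λ₂⌉, and m ordinary steps
rotate it close to one (`norm_grover_selectGrover_sub_le`).

The cost is of order m M₂ M₁, that is R log²/(c ε²), which is below the claimed bound when R ≥ 1, c
≤ 1 and ε ≤ 2 (`cost_le`). For other parameters either no instance satisfies the hypotheses or ε >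
2, and the empty circuit works (`exists_circuit_of_trivial`). -/

theorem mul_apply (U V : E ≃ₗᵢ[ℂ] E) (x : E) : (U * V) x = U (V x) := rfl

theorem inv_apply_apply (U : E ≃ₗᵢ[ℂ] E) (x : E) : U⁻¹ (U x) = x := U.symm_apply_apply x

theorem apply_inv_apply (U : E ≃ₗᵢ[ℂ] E) (x : E) : U (U⁻¹ x) = x := U.apply_symm_apply x

theorem inner_inv_apply (U : E ≃ₗᵢ[ℂ] E) (x y : E) :
    inner ℂ x (U⁻¹ y) = inner ℂ (U x) y := by
  rw [← U.inner_map_map x, apply_inv_apply]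

variable [FiniteDimensional ℂ E]

/-- The amplitude amplification iterate of the unitary `U` with initial subspace `K` and target
subspace `L`. -/
def grover (U : E ≃ₗᵢ[ℂ] E) (K L : Submodule ℂ E) : E ≃ₗᵢ[ℂ] E :=
  K.reflection * U⁻¹ * Lᗮ.reflection * U

/-- `v ∈ K` and `w ∈ L` form a pair of singular vectors, with singular value `s`, of the
compression of `U` to a map from `K` to `L`. -/
structure IsSingularPair (U : E ≃ₗᵢ[ℂ] E) (K L : Submodule ℂ E) (s : ℝ) (v w : E) : Prop where
  left_mem : v ∈ K
  right_mem : w ∈ L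
  proj_right : L.starProjection (U v) = (s : ℂ) • w
  proj_left : K.starProjection (U⁻¹ w) = (s : ℂ) • v

theorem cos_two_mul_eq (θ : ℝ) : Real.cos (2 * θ) = 1 - 2 * Real.sin θ ^ 2 := by
  rw [Real.cos_two_mul, Real.cos_sq']; ring

theorem grover_apply (U : E ≃ₗᵢ[ℂ] E) (K L : Submodule ℂ E) (x : E) :
    grover U K L x = (2 : ℂ) • K.starProjection (x - (2 : ℂ) • U⁻¹ (L.starProjection (U x))) -
      (x - (2 : ℂ) • U⁻¹ (L.starProjection (U x))) := by
  have h : Lᗮ.reflection (U x) = U x - (2 : ℂ) • L.starProjection (U x) := by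
    rw [Submodule.reflection_orthogonal_apply, Submodule.reflection_apply, two_smul, two_smul]
    abel
  calc grover U K L x = K.reflection (U⁻¹ (Lᗮ.reflection (U x))) := rfl
    _ = _ := by
      rw [h, map_sub, inv_apply_apply, map_smul, Submodule.reflection_apply, two_smul ℕ, two_smul ℂ (K.starProjection _)]

variable {U : E ≃ₗᵢ[ℂ] E} {K L : Submodule ℂ E} {v w : E} {θ : ℝ}

/-- With `grover_right`: for unit v and w, the vector U⁻¹w − sin θ v is orthogonal to K and has norm
cos θ, and the iterate rotates the plane it spans with v by 2θ. Leaving this vector unnormalized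
keeps the formulas valid when cos θ = 0 or w = 0. -/
theorem IsSingularPair.grover_left (h : IsSingularPair U K L (Real.sin θ) v w) :
    grover U K L v = (Real.cos (2 * θ) : ℂ) • v +
      (2 * Real.sin θ : ℂ) • (U⁻¹ w - (Real.sin θ : ℂ) • v) := by
  have hv := Submodule.starProjection_eq_self_iff.2 h.left_mem
  simp only [grover_apply, h.proj_right, map_sub, map_smul, h.proj_left, hv, cos_two_mul_eq]
  push_cast
  module

theorem IsSingularPair.grover_right (h : IsSingularPair U K L (Real.sin θ) v w) :
    grover U K L (U⁻¹ w - (Real.sin θ : ℂ) • v) =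
      (-(2 * Real.sin θ * Real.cos θ ^ 2) : ℂ) • v +
      (Real.cos (2 * θ) : ℂ) • (U⁻¹ w - (Real.sin θ : ℂ) • v) := by
  have hv := Submodule.starProjection_eq_self_iff.2 h.left_mem
  have hw := Submodule.starProjection_eq_self_iff.2 h.right_mem
  have hc : (Real.cos θ : ℂ) ^ 2 = 1 - (Real.sin θ : ℂ) ^ 2 := by
    exact_mod_cast Real.cos_sq' θ
  simp only [grover_apply, apply_inv_apply, hw, h.proj_right, map_sub, map_smul, h.proj_left, hv,
    hc, cos_two_mul_eq]
  push_cast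
  module

/-- Amplitude amplification acts on a singular value `sin θ` as a Chebyshev polynomial. -/
theorem IsSingularPair.proj_grover_pow (h : IsSingularPair U K L (Real.sin θ) v w) (j : ℕ) :
    L.starProjection (U ((grover U K L ^ j) v)) = (Real.sin ((2 * j + 1) * θ) : ℂ) • w := by
  -- The coefficient β is sin(2jθ)/cos θ; the product form avoids dividing by cos θ.
  have key : ∃ β : ℝ, (grover U K L ^ j) v = (Real.cos (2 * j * θ) : ℂ) • v +
      (β : ℂ) • (U⁻¹ w - (Real.sin θ : ℂ) • v) ∧ β * Real.cos θ = Real.sin (2 * j * θ) := by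
    induction j with
    | zero => exact ⟨0, by simp, by simp⟩
    | succ j ih =>
      obtain ⟨β, h1, h2⟩ := ih
      have h2' : (β : ℂ) * Real.cos θ = Real.sin (2 * j * θ) := by exact_mod_cast h2
      refine ⟨2 * Real.sin θ * Real.cos (2 * j * θ) + Real.cos (2 * θ) * β, ?_, ?_⟩
      · rw [pow_succ', mul_apply, h1, map_add, map_smul, map_smul, h.grover_left,
          h.grover_right]
        have : Real.cos (2 * ((j + 1 : ℕ) : ℝ) * θ) = Real.cos (2 * j * θ) * Real.cos (2 * θ) -
            2 * Real.sin θ * Real.cos θ * Real.sin (2 * j * θ) := by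
          rw [← Real.sin_two_mul, mul_comm (Real.sin (2 * θ)), ← Real.cos_add]
          push_cast; ring_nf
        rw [this]
        simp only [Complex.ofReal_add, Complex.ofReal_sub, Complex.ofReal_mul, ← h2',
          Complex.ofReal_ofNat]
        module
      · rw [add_mul, mul_assoc (Real.cos (2 * θ)), h2]
        have : Real.sin (2 * ((j + 1 : ℕ) : ℝ) * θ) = Real.sin (2 * j * θ) * Real.cos (2 * θ) +
            Real.cos (2 * j * θ) * Real.sin (2 * θ) := by
          rw [← Real.sin_add]; push_cast; ring_nf
        rw [this, Real.sin_two_mul]; ring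
  obtain ⟨β, h1, h2⟩ := key
  have hw := Submodule.starProjection_eq_self_iff.2 h.right_mem
  have h3 : Real.sin ((2 * j + 1) * θ) = Real.cos (2 * j * θ) * Real.sin θ +
      β * (1 - Real.sin θ ^ 2) := by
    rw [add_mul, one_mul, Real.sin_add, ← h2, ← Real.cos_sq']; ring
  rw [h1, h3]
  simp only [map_add, map_smul, map_sub, apply_inv_apply, h.proj_right, hw]
  push_cast
  module

/-- If the initial subspace is a line, the projection of the image to the target subspace
determines a singular pair. -/
theorem isSingularPair_span_singleton {e : E} (he : ‖e‖ = 1) {s : ℝ} (hw : w ∈ L) (hw1 : ‖w‖ = 1)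
    (h : L.starProjection (U e) = (s : ℂ) • w) :
    IsSingularPair U (Submodule.span ℂ {e}) L s e w where
  left_mem := Submodule.mem_span_singleton_self e
  right_mem := hw
  proj_right := h
  proj_left := by
    rw [Submodule.starProjection_unit_singleton ℂ he, inner_inv_apply]
    congr 1
    rw [← Submodule.starProjection_eq_self_iff.2 hw, ← Submodule.inner_starProjection_left_eq_right, h,
      inner_smul_left, inner_self_eq_norm_sq_to_K, hw1]
    simp

/-- This is what allows a singular value s to be written as sin(arcsin s). -/
theorem IsSingularPair.norm_le_one {s : ℝ} (h : IsSingularPair U K L s v w) (hv : ‖v‖ = 1)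
    (hw : ‖w‖ = 1) : |s| ≤ 1 := by
  have h1 := L.norm_starProjection_apply_le (U v)
  rw [h.proj_right, norm_smul, hw, U.norm_map, hv] at h1
  simpa using h1

/-- A unit vector whose projection to a subspace is a multiple of a unit vector `w` is close to
`w` if the multiple is close to one. -/
theorem norm_sub_sq_of_proj {y : E} (hy : ‖y‖ = 1) (hw : w ∈ L) (hw1 : ‖w‖ = 1) {s : ℝ}
    (h : L.starProjection y = (s : ℂ) • w) : ‖y - w‖ ^ 2 = 2 - 2 * s := by
  have : inner ℂ y w = (s : ℂ) := by
    rw [← Submodule.starProjection_eq_self_iff.2 hw, ← Submodule.inner_starProjection_left_eq_right, h,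
      inner_smul_left, inner_self_eq_norm_sq_to_K, hw1]
    simp
  rw [@norm_sub_sq ℂ, this, hy, hw1]
  simp
  ring

end Amplification

/-! ### Selection of unitaries by an ancilla register -/

section Select

variable {E J : Type*}

/-- The space `E ⊗ ℂ^J`. -/
def Reg (J : Type*) (E : Type*) : Type _ := PiLp 2 fun _ : J => E

/-- The component `⟨j|z⟩`. -/
def Reg.coord (z : Reg J E) (j : J) : E := WithLp.ofLp z j

/-- The vector with given components. -/
def Reg.mk (z : J → E) : Reg J E := WithLp.toLp 2 z

instance : CoeFun (Reg J E) fun _ => J → E := ⟨Reg.coord⟩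

@[ext] theorem Reg.ext {x y : Reg J E} (h : ∀ j, x j = y j) : x = y := PiLp.ext h

@[simp] theorem Reg.mk_apply (z : J → E) (j : J) : Reg.mk z j = z j := rfl

variable [NormedAddCommGroup E] [Fintype J]

instance : NormedAddCommGroup (Reg J E) :=
  inferInstanceAs (NormedAddCommGroup (PiLp 2 fun _ : J => E))

@[simp] theorem Reg.add_apply (x y : Reg J E) (j : J) : (x + y) j = x j + y j := rfl

theorem Reg.norm_sq_eq (x : Reg J E) : ‖x‖ ^ 2 = ∑ j, ‖x j‖ ^ 2 :=
  PiLp.norm_sq_eq_of_L2 (fun _ : J => E) x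

variable [InnerProductSpace ℂ E]

instance : InnerProductSpace ℂ (Reg J E) :=
  inferInstanceAs (InnerProductSpace ℂ (PiLp 2 fun _ : J => E))

instance [FiniteDimensional ℂ E] : FiniteDimensional ℂ (Reg J E) :=
  inferInstanceAs (FiniteDimensional ℂ (PiLp 2 fun _ : J => E))

@[simp] theorem Reg.smul_apply (c : ℂ) (x : Reg J E) (j : J) : (c • x) j = c • x j := rfl

theorem Reg.inner_eq (x y : Reg J E) : inner ℂ x y = ∑ j, inner ℂ (x j) (y j) :=
  PiLp.inner_apply (𝕜 := ℂ) (f := fun _ : J => E) x y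

/-- The block diagonal unitary `∑ j, f j ⊗ |j⟩⟨j|`. -/
def select : (J → (E ≃ₗᵢ[ℂ] E)) →* (Reg J E ≃ₗᵢ[ℂ] Reg J E) where
  toFun f := (LinearIsometryEquiv.piLpCongrRight 2 f :
    (PiLp 2 fun _ : J => E) ≃ₗᵢ[ℂ] PiLp 2 fun _ : J => E)
  map_one' := by ext x; rfl
  map_mul' f g := by ext x; rfl

@[simp] theorem select_apply (f : J → (E ≃ₗᵢ[ℂ] E)) (z : Reg J E) (j : J) :
    select f z j = f j (z j) := rfl

/-- The unitary `U ⊗ 1`. -/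
def extend (J : Type*) [Fintype J] : (E ≃ₗᵢ[ℂ] E) →* (Reg J E ≃ₗᵢ[ℂ] Reg J E) :=
  select.comp (Pi.constMonoidHom J _)

@[simp] theorem extend_apply (U : E ≃ₗᵢ[ℂ] E) (z : Reg J E) (j : J) :
    extend J U z j = U (z j) := rfl

/-- The map `y ↦ y ⊗ p` for a unit vector `p` with real amplitudes. -/
def attach (p : J → ℝ) (hp : ∑ j, p j ^ 2 = 1) : E →ₗᵢ[ℂ] Reg J E where
  toFun y := Reg.mk fun j => (p j : ℂ) • y
  map_add' x y := by ext j; simp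
  map_smul' c x := by ext j; exact smul_comm _ _ _
  norm_map' x := by
    rw [← sq_eq_sq₀ (norm_nonneg _) (norm_nonneg _), Reg.norm_sq_eq]
    change ∑ j, ‖(p j : ℂ) • x‖ ^ 2 = ‖x‖ ^ 2
    simp only [norm_smul, mul_pow, ← Finset.sum_mul, Complex.norm_real, Real.norm_eq_abs, sq_abs,
      hp, one_mul]

@[simp] theorem attach_apply (p : J → ℝ) (hp : ∑ j, p j ^ 2 = 1) (y : E) (j : J) :
    attach p hp y j = (p j : ℂ) • y := rfl

theorem extend_attach (U : E ≃ₗᵢ[ℂ] E) (p : J → ℝ) (hp : ∑ j, p j ^ 2 = 1) (y : E) :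
    extend J U (attach p hp y) = attach p hp (U y) := by
  ext j
  simp only [extend_apply, attach_apply, map_smul]

/-- Identifies the adjoint of `attach p`, so that compressing a block diagonal unitary averages its
blocks. -/
theorem inner_attach (p : J → ℝ) (hp : ∑ j, p j ^ 2 = 1) (y : E) (z : Reg J E) :
    inner ℂ (attach p hp y) z = inner ℂ y (∑ j, (p j : ℂ) • z j) := by
  simp only [Reg.inner_eq, inner_sum, inner_smul_left, inner_smul_right, attach_apply,
    Complex.conj_ofReal]

variable [FiniteDimensional ℂ E]

theorem starProjection_map_attach (p : J → ℝ) (hp : ∑ j, p j ^ 2 = 1) (L : Submodule ℂ E)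
    (z : Reg J E) :
    (L.map (attach p hp).toLinearMap).starProjection z =
      attach p hp (L.starProjection (∑ j, (p j : ℂ) • z j)) := by
  apply Submodule.eq_starProjection_of_mem_of_inner_eq_zero
  · exact Submodule.mem_map_of_mem (Submodule.starProjection_apply_mem _ _)
  · rintro _ ⟨y, hy, rfl⟩
    have h1 := inner_attach p hp y z
    have h2 := Submodule.starProjection_inner_eq_zero (∑ j, (p j : ℂ) • z j) y hy
    rw [← inner_conj_symm, map_eq_zero, inner_sub_right] at h2 ⊢
    simp only [LinearIsometry.coe_toLinearMap, LinearIsometry.inner_map_map]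
    rw [h1]; exact h2

/-- A linear combination of unitaries as a block of a block diagonal unitary. -/
theorem starProjection_select_attach (f : J → (E ≃ₗᵢ[ℂ] E)) (p q : J → ℝ)
    (hp : ∑ j, p j ^ 2 = 1) (hq : ∑ j, q j ^ 2 = 1) (L : Submodule ℂ E) (y : E) :
    (L.map (attach q hq).toLinearMap).starProjection (select f (attach p hp y)) =
      attach q hq (∑ j, ((q j * p j : ℝ) : ℂ) • L.starProjection (f j y)) := by
  rw [starProjection_map_attach]
  simp only [select_apply, attach_apply, map_sum, map_smul, smul_smul, Complex.ofReal_mul]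

/-- The unitary that applies `j` steps of amplitude amplification (but at most `d`), where `j` is
read from a register. -/
def selectGrover (U : E ≃ₗᵢ[ℂ] E) (K L : Submodule ℂ E) (d : ℕ) (idx : J → ℕ) :
    Reg J E ≃ₗᵢ[ℂ] Reg J E :=
  select fun j => U * grover U K L ^ min (idx j) d

theorem selectGrover_zero (U : E ≃ₗᵢ[ℂ] E) (K L : Submodule ℂ E) (idx : J → ℕ) :
    selectGrover U K L 0 idx = extend J U := by
  simp [selectGrover, extend]; rfl

/-- Only the reflections have to be controlled by the register. -/
theorem selectGrover_succ (U : E ≃ₗᵢ[ℂ] E) (K L : Submodule ℂ E) (d : ℕ) (idx : J → ℕ) :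
    selectGrover U K L (d + 1) idx = selectGrover U K L d idx *
      (select (fun j => if d < idx j then K.reflection else 1) * ((extend J U)⁻¹ *
        (select (fun j => if d < idx j then Lᗮ.reflection else 1) * extend J U))) := by
  simp only [selectGrover, extend, MonoidHom.comp_apply, ← map_inv, ← map_mul]
  congr 1
  funext j
  simp only [Pi.mul_apply, Pi.constMonoidHom_apply, Function.const_apply]
  split_ifs with h
  · rw [min_eq_right h, min_eq_right h.le, pow_succ]
    simp only [grover, mul_assoc]
  -- Both controlled reflections are 1 on this branch, so U⁻¹ and U cancel although they are applied
  -- without control.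
  · rw [min_eq_left (by omega), min_eq_left (by omega)]
    group

/-- The register averages the Chebyshev values sin((2j+1)θ) with weights q j * p j. The singular
pair persists; only its singular value changes. -/
theorem IsSingularPair.starProjection_selectGrover {U : E ≃ₗᵢ[ℂ] E} {K L : Submodule ℂ E} {v w : E}
    {θ : ℝ} (h : IsSingularPair U K L (Real.sin θ) v w) (d : ℕ) (idx : J → ℕ)
    (hd : ∀ j, idx j ≤ d) (p q : J → ℝ)
    (hp : ∑ j, p j ^ 2 = 1) (hq : ∑ j, q j ^ 2 = 1) :
    (L.map (attach q hq).toLinearMap).starProjection (selectGrover U K L d idx (attach p hp v)) =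
      ((∑ j, q j * p j * Real.sin ((2 * idx j + 1) * θ) : ℝ) : ℂ) • attach q hq w := by
  rw [selectGrover, starProjection_select_attach]
  simp only [min_eq_left (hd _), mul_apply, h.proj_grover_pow, smul_smul]
  rw [← Finset.sum_smul, map_smul]
  push_cast
  rfl

end Select

/-! ### Unitaries generated by oracles -/

section Oracles

variable {O : Type*} {E : Type*} [NormedAddCommGroup E] [InnerProductSpace ℂ E]

/-- `Implementable S T N F`: the unitary `F`, which depends on oracles of type `O`, is a product of
fixed unitaries, elements of `S`, and at most `N` elements of `T`. -/
inductive Implementable (S T : Set (O → (E ≃ₗᵢ[ℂ] E))) : ℕ → (O → (E ≃ₗᵢ[ℂ] E)) → Prop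
  | fixed (V : E ≃ₗᵢ[ℂ] E) : Implementable S T 0 (fun _ => V)
  | free {F : O → (E ≃ₗᵢ[ℂ] E)} : F ∈ S → Implementable S T 0 F
  | counted {F : O → (E ≃ₗᵢ[ℂ] E)} : F ∈ T → Implementable S T 1 F
  | mul {N M : ℕ} {F G : O → (E ≃ₗᵢ[ℂ] E)} :
      Implementable S T N F → Implementable S T M G → Implementable S T (N + M) (F * G)

variable {S T : Set (O → (E ≃ₗᵢ[ℂ] E))} {N : ℕ} {F : O → (E ≃ₗᵢ[ℂ] E)}

theorem Implementable.inv (hS : ∀ F ∈ S, F⁻¹ ∈ S) (hT : ∀ F ∈ T, F⁻¹ ∈ T)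
    (h : Implementable S T N F) : Implementable S T N F⁻¹ := by
  induction h with
  | fixed V => exact .fixed V⁻¹
  | free h => exact .free (hS _ h)
  | counted h => exact .counted (hT _ h)
  | mul _ _ h1 h2 => rw [mul_inv_rev, add_comm]; exact h2.mul h1

theorem Implementable.map {E' : Type*} [NormedAddCommGroup E'] [InnerProductSpace ℂ E']
    (Φ : (E ≃ₗᵢ[ℂ] E) →* (E' ≃ₗᵢ[ℂ] E')) (h : Implementable S T N F) :
    Implementable ((fun F o => Φ (F o)) '' S) ((fun F o => Φ (F o)) '' T) N (fun o => Φ (F o)) := by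
  induction h with
  | fixed V => exact .fixed (Φ V)
  | free h => exact .free ⟨_, h, rfl⟩
  | counted h => exact .counted ⟨_, h, rfl⟩
  | mul _ _ h1 h2 =>
    convert h1.mul h2 using 1
    funext o
    simp

theorem image_inv_mem {E' : Type*} [NormedAddCommGroup E'] [InnerProductSpace ℂ E']
    (Φ : (E ≃ₗᵢ[ℂ] E) →* (E' ≃ₗᵢ[ℂ] E')) (hS : ∀ F ∈ S, F⁻¹ ∈ S) :
    ∀ F ∈ (fun F o => Φ (F o)) '' S, F⁻¹ ∈ (fun F o => Φ (F o)) '' S := by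
  rintro _ ⟨F, hF, rfl⟩
  exact ⟨F⁻¹, hS F hF, by funext o; simp⟩

variable [FiniteDimensional ℂ E]

theorem Implementable.grover_pow (hS : ∀ F ∈ S, F⁻¹ ∈ S) (hT : ∀ F ∈ T, F⁻¹ ∈ T)
    (h : Implementable S T N F) (K L : Submodule ℂ E) (m : ℕ) :
    Implementable S T ((2 * m + 1) * N) (fun o => F o * grover (F o) K L ^ m) := by
  induction m with
  | zero => simpa using h
  | succ m ih =>
    convert ih.mul ((((Implementable.fixed K.reflection).mul (h.inv hS hT)).mul
      (.fixed Lᗮ.reflection)).mul h) using 1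
    · ring
    · funext o
      simp only [pow_succ, Pi.mul_apply, grover, Pi.inv_apply, mul_assoc]

/-- A superposition of all powers up to d costs no more than the largest power, since only the
reflections, which are fixed unitaries, are controlled. -/
theorem Implementable.selectGrover (hS : ∀ F ∈ S, F⁻¹ ∈ S) (hT : ∀ F ∈ T, F⁻¹ ∈ T)
    (h : Implementable S T N F) (K L : Submodule ℂ E) (d : ℕ) {J : Type*} [Fintype J] (idx : J → ℕ) :
    Implementable ((fun F o => extend J (F o)) '' S) ((fun F o => extend J (F o)) '' T)
      ((2 * d + 1) * N) (fun o => selectGrover (F o) K L d idx) := by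
  have hE := h.map (extend J)
  induction d with
  | zero => simpa [selectGrover_zero] using hE
  | succ d ih =>
    convert ih.mul ((Implementable.fixed
      (select (fun j => if d < idx j then K.reflection else 1))).mul ((hE.inv (image_inv_mem _ hS)
        (image_inv_mem _ hT)).mul ((Implementable.fixed
          (select (fun j => if d < idx j then Lᗮ.reflection else 1))).mul hE))) using 1
    · ring
    · funext o
      rw [selectGrover_succ]
      rfl

end Oracles

/-- Two isometric embeddings of a space differ by a unitary. -/
theorem exists_unitary_comp_eq {D E : Type*} [NormedAddCommGroup D] [InnerProductSpace ℂ D]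
    [NormedAddCommGroup E] [InnerProductSpace ℂ E] [FiniteDimensional ℂ E] (f g : D →ₗᵢ[ℂ] E) :
    ∃ V : E ≃ₗᵢ[ℂ] E, ∀ x, V (f x) = g x := by
  let R := (g.comp f.equivRange.symm.toLinearIsometry)
  refine ⟨R.extend.toLinearIsometryEquiv rfl, fun x => ?_⟩
  have := R.extend_apply (f.equivRange x)
  simpa [R] using this

theorem exists_unitary_apply_eq {E : Type*} [NormedAddCommGroup E] [InnerProductSpace ℂ E]
    [FiniteDimensional ℂ E] {x y : E} (hx : ‖x‖ = 1) (hy : ‖y‖ = 1) :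
    ∃ V : E ≃ₗᵢ[ℂ] E, V x = y := by
  obtain ⟨V, hV⟩ := exists_unitary_comp_eq (LinearIsometry.toSpanSingleton ℂ E hx)
    (LinearIsometry.toSpanSingleton ℂ E hy)
  exact ⟨V, by simpa using hV 1⟩

/-! ### The Fourier series of the square wave -/

/-- Partial sums of the Fourier series of the square wave. -/
def squareWave (M : ℕ) (θ : ℝ) : ℝ :=
  ∑ j ∈ Finset.range M, Real.sin ((2 * j + 1) * θ) / (2 * j + 1)

/-- Telescoping: 2 sin θ cos((2j+1)θ) = sin((2j+2)θ) − sin(2jθ). It gives the derivative of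
`squareWave` in closed form. -/
theorem two_mul_sin_mul_sum_cos (M : ℕ) (θ : ℝ) :
    2 * Real.sin θ * ∑ j ∈ Finset.range M, Real.cos ((2 * j + 1) * θ) = Real.sin (2 * M * θ) := by
  induction M with
  | zero => simp
  | succ M ih =>
    rw [Finset.sum_range_succ, mul_add, ih]
    have h1 : Real.sin (2 * M * θ) = Real.sin ((2 * M + 1) * θ - θ) := by ring_nf
    have h2 : Real.sin (2 * (M + 1 : ℕ) * θ) = Real.sin ((2 * M + 1) * θ + θ) := by
      push_cast; ring_nf
    rw [h1, h2, Real.sin_add, Real.sin_sub]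
    ring

theorem hasDerivAt_squareWave (M : ℕ) (θ : ℝ) :
    HasDerivAt (squareWave M) (∑ j ∈ Finset.range M, Real.cos ((2 * j + 1) * θ)) θ := by
  unfold squareWave
  apply HasDerivAt.fun_sum
  intro j _
  have h : HasDerivAt (fun t : ℝ => Real.sin ((2 * j + 1) * t) / (2 * j + 1))
      (Real.cos ((2 * j + 1) * θ) * ((2 * j + 1) * 1) / (2 * j + 1)) θ :=
    (((hasDerivAt_id θ).const_mul (2 * (j : ℝ) + 1)).sin).div_const _
  refine h.congr_deriv ?_
  have : (2 * (j : ℝ) + 1) ≠ 0 := by positivity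
  rw [mul_one, mul_div_cancel_right₀ _ this]

/-- At π/2 the sum is Leibniz's alternating series. A partial sum with an even number of terms lies
below the limit, and the next term 1/(4k+1) bounds the gap. -/
theorem abs_squareWave_pi_div_two_sub (k : ℕ) :
    |squareWave (2 * k) (Real.pi / 2) - Real.pi / 4| ≤ 1 / (4 * k + 1) := by
  have hs : ∀ M, squareWave M (Real.pi / 2) = ∑ i ∈ Finset.range M, (-1) ^ i * (1 / (2 * (i : ℝ) + 1)) := by
    intro M
    refine Finset.sum_congr rfl fun i _ => ?_
    have : (2 * (i : ℝ) + 1) * (Real.pi / 2) = Real.pi / 2 + i * Real.pi := by ring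
    rw [this, Real.sin_add_nat_mul_pi, Real.sin_pi_div_two]
    ring
  have ht : Filter.Tendsto (fun n => ∑ i ∈ Finset.range n, (-1) ^ i * (1 / (2 * (i : ℝ) + 1)))
      Filter.atTop (nhds (Real.pi / 4)) := by
    convert Real.tendsto_sum_pi_div_four using 4
    ring
  have ha : Antitone fun i : ℕ => 1 / (2 * (i : ℝ) + 1) := by
    intro i j hij
    have : (i : ℝ) ≤ j := by exact_mod_cast hij
    exact one_div_le_one_div_of_le (by positivity) (by linarith)
  have h1 := ha.alternating_series_le_tendsto ht k
  have h2 := ha.tendsto_le_alternating_series ht k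
  rw [Finset.sum_range_succ, pow_mul] at h2
  rw [hs, abs_le]
  push_cast at h2
  have e : 2 * (2 * (k : ℝ)) + 1 = 4 * k + 1 := by ring
  rw [e] at h2
  have : 0 < 1 / (4 * (k : ℝ) + 1) := by positivity
  constructor <;> simp at * <;> linarith

/-- Both h + g and h − g are antitone on the interval. -/
theorem abs_sub_le_of_hasDerivAt {g h g' h' : ℝ → ℝ} {a b : ℝ} (hab : a ≤ b)
    (hg : ∀ t ∈ Set.Icc a b, HasDerivAt g (g' t) t) (hh : ∀ t ∈ Set.Icc a b, HasDerivAt h (h' t) t)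
    (hb : ∀ t ∈ Set.Icc a b, |g' t| ≤ -h' t) : |g a - g b| ≤ h a - h b := by
  have key : ∀ f f' : ℝ → ℝ, (∀ t ∈ Set.Icc a b, HasDerivAt f (f' t) t) →
      (∀ t ∈ Set.Icc a b, f' t ≤ 0) → f b ≤ f a := by
    intro f f' hf hf'
    refine antitoneOn_of_deriv_nonpos (convex_Icc a b)
      (fun t ht => (hf t ht).continuousAt.continuousWithinAt)
      (fun t ht => (hf t (interior_subset ht)).differentiableAt.differentiableWithinAt)
      (fun t ht => ?_) (Set.left_mem_Icc.2 hab) (Set.right_mem_Icc.2 hab) hab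
    rw [(hf t (interior_subset ht)).deriv]
    exact hf' t (interior_subset ht)
  have h1 := key (fun t => h t + g t) (fun t => h' t + g' t)
    (fun t ht => (hh t ht).add (hg t ht)) (fun t ht => by
      have := (abs_le.1 (hb t ht)).2; linarith)
  have h2 := key (fun t => h t - g t) (fun t => h' t - g' t)
    (fun t ht => (hh t ht).sub (hg t ht)) (fun t ht => by
      have := (abs_le.1 (hb t ht)).1; linarith)
  rw [abs_le]
  constructor <;> linarith

/-- Away from its jumps, the Fourier series of the square wave converges at rate `1 / M`. -/
theorem abs_squareWave_sub_le {k : ℕ} (hk : 0 < k) {θ : ℝ} (h0 : 0 < θ) (h1 : θ ≤ Real.pi / 2) :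
    |squareWave (2 * k) θ - Real.pi / 4| ≤ 2 / ((2 * k : ℕ) * Real.sin θ) := by
  have hk' : (0 : ℝ) < k := by exact_mod_cast hk
  have hsin : ∀ t ∈ Set.Icc θ (Real.pi / 2), 0 < Real.sin t := fun t ht =>
    Real.sin_pos_of_pos_of_lt_pi (by linarith [ht.1]) (by linarith [ht.2, Real.pi_pos])
  have hθ := hsin θ ⟨le_rfl, h1⟩
  set M : ℝ := ((2 * k : ℕ) : ℝ) with hM
  have hM0 : 0 < M := by rw [hM]; push_cast; positivity
  -- Integration by parts in disguise. The derivative sin(2Mt)/(2 sin t) of the partial sum only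
  -- oscillates; adding cos(2Mt)/(4M sin t) cancels it and leaves a derivative dominated by that of
  -- 1/(4M sin t).
  have main := abs_sub_le_of_hasDerivAt
    (g := fun t => squareWave (2 * k) t + Real.cos (2 * M * t) / (4 * M * Real.sin t))
    (h := fun t => 1 / (4 * M * Real.sin t))
    (g' := fun t => -(Real.cos (2 * M * t) * Real.cos t / (4 * M * Real.sin t ^ 2)))
    (h' := fun t => -(Real.cos t / (4 * M * Real.sin t ^ 2))) h1
    (fun t ht => by
      have hs := hsin t ht
      have hc : HasDerivAt (fun t => Real.cos (2 * M * t)) (-Real.sin (2 * M * t) * (2 * M * 1)) t :=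
        ((hasDerivAt_id t).const_mul (2 * M)).cos
      have hd := (hasDerivAt_squareWave (2 * k) t).add
        (hc.div ((Real.hasDerivAt_sin t).const_mul (4 * M)) (by positivity))
      refine hd.congr_deriv ?_
      have hsum := two_mul_sin_mul_sum_cos (2 * k) t
      rw [← hM] at hsum
      have hsum' : ∑ j ∈ Finset.range (2 * k), Real.cos ((2 * j + 1) * t) =
          Real.sin (2 * M * t) / (2 * Real.sin t) := by
        rw [eq_div_iff (by positivity), ← hsum]; ring
      rw [hsum']
      field_simp
      ring)
    (fun t ht => by
      have hs := hsin t ht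
      have hd := (hasDerivAt_const t (1 : ℝ)).div ((Real.hasDerivAt_sin t).const_mul (4 * M))
        (by positivity)
      refine hd.congr_deriv ?_
      field_simp
      ring)
    (fun t ht => by
      have hs := hsin t ht
      have hcos : 0 ≤ Real.cos t := Real.cos_nonneg_of_mem_Icc ⟨by linarith [ht.1, Real.pi_pos], ht.2⟩
      rw [abs_neg, neg_neg, abs_div, abs_mul, abs_of_nonneg hcos,
        abs_of_pos (by positivity : 0 < 4 * M * Real.sin t ^ 2)]
      gcongr
      exact mul_le_of_le_one_left hcos (Real.abs_cos_le_one _))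
  simp only [Real.sin_pi_div_two, mul_one] at main
  have hpi := abs_squareWave_pi_div_two_sub k
  have e1 : |Real.cos (2 * M * θ) / (4 * M * Real.sin θ)| ≤ 1 / (4 * M * Real.sin θ) := by
    rw [abs_div, abs_of_pos (by positivity : 0 < 4 * M * Real.sin θ)]
    gcongr
    exact Real.abs_cos_le_one _
  have e2 : |Real.cos (2 * M * (Real.pi / 2)) / (4 * M)| ≤ 1 / (4 * M) := by
    rw [abs_div, abs_of_pos (by positivity : 0 < 4 * M)]
    gcongr
    exact Real.abs_cos_le_one _
  have e3 : 1 / (4 * (k : ℝ) + 1) ≤ 1 / (2 * M) := by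
    apply one_div_le_one_div_of_le (by positivity)
    rw [hM]; push_cast; linarith
  have e4 : 1 / M ≤ 1 / (M * Real.sin θ) := by
    apply one_div_le_one_div_of_le (by positivity)
    exact mul_le_of_le_one_right hM0.le (Real.sin_le_one _)
  have f1 : 1 / (4 * M * Real.sin θ) = 1 / (M * Real.sin θ) / 4 := by field_simp
  have f2 : 1 / (4 * M) = 1 / M / 4 := by field_simp
  have f3 : 1 / (2 * M) = 1 / M / 2 := by field_simp
  have f4 : 2 / (M * Real.sin θ) = 2 * (1 / (M * Real.sin θ)) := by ring
  rw [f4]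
  rw [f1] at main e1
  rw [f2] at main e2
  rw [f3] at e3
  have hMp : 0 < 1 / M := by positivity
  -- In units of 1/(M sin θ), the errors are at most 1/4 from `main`, 1/4 and 1/4 from the two
  -- boundary terms and 1/2 from the value at π/2, together 5/4 ≤ 2.
  rw [abs_le] at *
  constructor <;> linarith [main.1, main.2, hpi.1, hpi.2, e1.1, e1.2, e2.1, e2.2]

/-- The sum of the coefficients of the square wave. -/
def weight (M : ℕ) : ℝ := ∑ j ∈ Finset.range M, 1 / (2 * (j : ℝ) + 1)

theorem one_le_weight {M : ℕ} (hM : 0 < M) : 1 ≤ weight M := by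
  have := Finset.single_le_sum (s := Finset.range M) (f := fun j : ℕ => 1 / (2 * (j : ℝ) + 1))
    (fun j _ => by positivity) (Finset.mem_range.2 hM)
  simpa [weight] using this

theorem weight_le (M : ℕ) : weight M ≤ 1 + Real.log M := by
  refine le_trans ?_ (harmonic_le_one_add_log M)
  simp only [weight, harmonic]
  push_cast
  refine Finset.sum_le_sum fun j _ => ?_
  rw [one_div]
  gcongr
  linarith [(Nat.cast_nonneg j : (0 : ℝ) ≤ j)]

/-- If the amplitude `s` is close to `sin (π / (2 (2 m + 1)))`, then `m` steps of amplitude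
amplification bring it close to one. -/
theorem one_sub_sin_mul_arcsin_le {m : ℕ} (hm : 1 ≤ m) {s δ : ℝ} (hδ : δ ≤ 1 / 2)
    (h : |s - Real.sin (Real.pi / (2 * (2 * m + 1)))| ≤
      δ * Real.sin (Real.pi / (2 * (2 * m + 1)))) :
    2 - 2 * Real.sin ((2 * m + 1) * Real.arcsin s) ≤ (Real.pi * δ) ^ 2 := by
  have hm' : (1 : ℝ) ≤ m := by exact_mod_cast hm
  set t := Real.pi / (2 * (2 * m + 1)) with ht
  have hpi := Real.pi_pos
  have ht0 : 0 < t := by positivity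
  have ht1 : t ≤ Real.pi / 6 := by
    rw [ht]; exact div_le_div_of_nonneg_left hpi.le (by norm_num) (by linarith)
  have hst : Real.sin t ≤ 1 / 2 := by
    rw [← Real.sin_pi_div_six]
    exact Real.sin_le_sin_of_le_of_le_pi_div_two (by linarith) (by linarith) ht1
  have hst0 : 0 < Real.sin t := Real.sin_pos_of_pos_of_lt_pi ht0 (by linarith)
  have hδ0 : 0 ≤ δ := by
    by_contra hneg
    have := abs_nonneg (s - Real.sin t)
    nlinarith
  have hs := abs_le.1 h
  have hs0 : 0 ≤ s := by nlinarith
  have hs1 : s ≤ 3 / 4 := by nlinarith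
  set θ := Real.arcsin s with hθ
  have hsθ : Real.sin θ = s := Real.sin_arcsin (by linarith) (by linarith)
  have hθ0 : 0 ≤ θ := Real.arcsin_nonneg.2 hs0
  have hθ1 : θ ≤ Real.pi / 3 := by
    apply Real.arcsin_le_iff_le_sin' (by constructor <;> linarith) |>.2
    rw [Real.sin_pi_div_three]
    have : (3 / 2 : ℝ) ≤ √3 := Real.le_sqrt_of_sq_le (by norm_num)
    linarith
  -- On [0, π/3] the cosine is at least 1/2, so arcsin is 2-Lipschitz there.
  have hlip : |θ - t| ≤ 2 * |s - Real.sin t| := by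
    have hmono : MonotoneOn (fun u => 2 * Real.sin u - u) (Set.Icc 0 (Real.pi / 3)) := by
      apply monotoneOn_of_deriv_nonneg (convex_Icc _ _) (by fun_prop) (by fun_prop)
      intro u hu
      rw [interior_Icc] at hu
      have hd : HasDerivAt (fun u => 2 * Real.sin u - u) (2 * Real.cos u - 1) u :=
        ((Real.hasDerivAt_sin u).const_mul 2).sub (hasDerivAt_id u)
      rw [hd.deriv]
      have := Real.cos_le_cos_of_nonneg_of_le_pi hu.1.le (by linarith) hu.2.le
      rw [Real.cos_pi_div_three] at this
      linarith
    have h1 : t ∈ Set.Icc 0 (Real.pi / 3) := ⟨ht0.le, by linarith⟩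
    have h2 : θ ∈ Set.Icc 0 (Real.pi / 3) := ⟨hθ0, hθ1⟩
    rcases le_total θ t with hle | hle
    · have := hmono h2 h1 hle
      simp only [hsθ] at this
      rw [abs_of_nonpos (by linarith), abs_sub_comm]
      linarith [le_abs_self (Real.sin t - s)]
    · have := hmono h1 h2 hle
      simp only [hsθ] at this
      rw [abs_of_nonneg (by linarith)]
      linarith [le_abs_self (s - Real.sin t)]
  -- Since (2m+1)t = π/2, the angle error 2δt grows to πδ.
  have hdist : |(2 * m + 1) * (θ - t)| ≤ Real.pi * δ := by
    rw [abs_mul, abs_of_pos (by positivity : (0 : ℝ) < 2 * m + 1)]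
    have h3 : |θ - t| ≤ 2 * (δ * t) :=
      hlip.trans (by
        have := Real.sin_le ht0.le
        nlinarith)
    calc (2 * (m : ℝ) + 1) * |θ - t| ≤ (2 * m + 1) * (2 * (δ * t)) := by gcongr
      _ = Real.pi * δ := by rw [ht]; field_simp
  have hcos : Real.sin ((2 * m + 1) * θ) = Real.cos ((2 * m + 1) * (θ - t)) := by
    rw [← Real.cos_sub_pi_div_two]
    congr 1
    rw [ht]; field_simp
  have hb := Real.one_sub_sq_div_two_le_cos (x := (2 * m + 1) * (θ - t))
  have hsq := sq_le_sq' (abs_le.1 hdist).1 (abs_le.1 hdist).2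
  rw [hcos]
  linarith

/-! ### Matrices acting on state vectors -/

section Matrices

variable {ι μ : Type} [Fintype ι] [Fintype μ]

theorem act_apply (M : Matrix ι μ ℂ) (x : Vec μ) (i : ι) : act M x i = ∑ j, M i j * x j := rfl

theorem act_sum {α : Type*} (s : Finset α) (M : α → Matrix ι μ ℂ) (x : Vec μ) :
    act (∑ k ∈ s, M k) x = ∑ k ∈ s, act (M k) x := by
  ext i
  simp only [act, Matrix.sum_mulVec, WithLp.ofLp_sum, Finset.sum_apply]

theorem act_smul (c : ℂ) (M : Matrix ι μ ℂ) (x : Vec μ) : act (c • M) x = c • act M x := by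
  ext i
  simp [act, Matrix.smul_mulVec]

theorem act_outer (x : Vec ι) (y z : Vec μ) : act (outer x y) z = inner ℂ y z • x := by
  ext i
  simp only [act_apply, outer, Matrix.of_apply, PiLp.smul_apply, smul_eq_mul, PiLp.inner_apply,
    RCLike.inner_apply, Finset.sum_mul]
  exact Finset.sum_congr rfl fun j _ => by rw [RCLike.star_def]; ring

theorem conjTranspose_outer (x : Vec ι) (y : Vec μ) : (outer x y)ᴴ = outer y x := by
  ext i j
  simp [outer, mul_comm]

theorem inner_tensor (x x' : Vec ι) (y y' : Vec μ) :
    inner ℂ (tensor x y) (tensor x' y') = inner ℂ x x' * inner ℂ y y' := by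
  simp only [PiLp.inner_apply, tensor, RCLike.inner_apply, Fintype.sum_prod_type, Finset.sum_mul_sum,
    map_mul]
  exact Finset.sum_congr rfl fun i _ => Finset.sum_congr rfl fun j _ => by ring

theorem norm_tensor (x : Vec ι) (y : Vec μ) : ‖tensor x y‖ = ‖x‖ * ‖y‖ := by
  rw [← sq_eq_sq₀ (norm_nonneg _) (by positivity), mul_pow]
  have h := inner_tensor x x y y
  simp only [inner_self_eq_norm_sq_to_K] at h
  exact_mod_cast h

/-- The isometry `y ↦ x ⊗ y` for a unit vector `x`. -/
def tensorLeft (x : Vec ι) (hx : ‖x‖ = 1) : Vec μ →ₗᵢ[ℂ] Vec (ι × μ) where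
  toFun y := tensor x y
  map_add' y y' := by ext i; simp [tensor, mul_add]
  map_smul' c y := by ext i; simp [tensor]; ring
  norm_map' y := by
    change ‖tensor x y‖ = ‖y‖
    rw [norm_tensor, hx, one_mul]

/-- The isometry `y ↦ y ⊗ x` for a unit vector `x`. -/
def tensorRight (x : Vec ι) (hx : ‖x‖ = 1) : Vec μ →ₗᵢ[ℂ] Vec (μ × ι) where
  toFun y := tensor y x
  map_add' y y' := by ext i; simp [tensor, add_mul]
  map_smul' c y := by ext i; simp [tensor]; ring
  norm_map' y := by
    change ‖tensor y x‖ = ‖y‖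
    rw [norm_tensor, hx, mul_one]

theorem act_kronecker (M : Matrix ι ι ℂ) (M' : Matrix μ μ ℂ) (x : Vec ι) (y : Vec μ) :
    act (M ⊗ₖ M') (tensor x y) = tensor (act M x) (act M' y) := by
  ext ⟨i, j⟩
  simp only [act_apply, tensor, Matrix.kroneckerMap_apply, Fintype.sum_prod_type, Finset.sum_mul_sum]
  exact Finset.sum_congr rfl fun i _ => Finset.sum_congr rfl fun j _ => by ring

theorem act_kronecker_one [DecidableEq μ] (M : Matrix ι ι ℂ) (z : Vec (ι × μ)) (i : ι) (k : μ) :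
    act (M ⊗ₖ (1 : Matrix μ μ ℂ)) z (i, k) = ∑ j, M i j * z (j, k) := by
  simp [act_apply, Fintype.sum_prod_type, Matrix.one_apply]

variable [DecidableEq ι] [DecidableEq μ]

theorem norm_ket (i : ι) : ‖ket i‖ = 1 := by simp [ket]

theorem inner_ket (i j : ι) : inner ℂ (ket i) (ket j) = if i = j then (1 : ℂ) else 0 := by
  simp [ket, EuclideanSpace.inner_single_left]

theorem act_one (x : Vec ι) : act (1 : Matrix ι ι ℂ) x = x := by
  simp [act]

theorem act_controlled (U : Matrix ι ι ℂ) (y : Vec ι) :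
    act (controlled U) (tensor (ket 1) y) = tensor (ket 1) (act U y) := by
  have h0 : act (Matrix.single 0 0 1 : Matrix (Fin 2) (Fin 2) ℂ) (ket 1) = 0 := by
    ext i; simp [act_apply, ket, Matrix.single_apply]
  have h1 : act (Matrix.single 1 1 1 : Matrix (Fin 2) (Fin 2) ℂ) (ket 1) = ket 1 := by
    ext i; fin_cases i <;> simp [act_apply, ket, Matrix.single_apply]
  have h2 : tensor (0 : Vec (Fin 2)) y = 0 := by ext i; simp [tensor]
  have h3 : ∀ (M M' : Matrix (Fin 2 × ι) (Fin 2 × ι) ℂ) (x), act (M + M') x = act M x + act M' x :=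
    fun M M' x => by ext i; simp [act, Matrix.add_mulVec]
  rw [controlled, h3, act_kronecker, act_kronecker, h0, h1, act_one, h2, zero_add]

/-- Unitary matrices as isometries. -/
def toIsometry : Matrix.unitaryGroup ι ℂ ≃* (Vec ι ≃ₗᵢ[ℂ] Vec ι) :=
  (Unitary.mapEquiv
    { (Matrix.toEuclideanCLM (𝕜 := ℂ) (n := ι) : Matrix ι ι ℂ ≃* (Vec ι →L[ℂ] Vec ι)) with
      map_star' := map_star (Matrix.toEuclideanCLM (𝕜 := ℂ) (n := ι)) }).toMulEquiv.trans
    Unitary.linearIsometryEquiv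

theorem toIsometry_apply (U : Matrix.unitaryGroup ι ℂ) (x : Vec ι) :
    toIsometry U x = act (U : Matrix ι ι ℂ) x := rfl

theorem act_symm_toIsometry (V : Vec ι ≃ₗᵢ[ℂ] Vec ι) (x : Vec ι) :
    act (toIsometry.symm V : Matrix ι ι ℂ) x = V x := by
  rw [← toIsometry_apply, MulEquiv.apply_symm_apply]

theorem controlled_mul (U V : Matrix ι ι ℂ) :
    controlled U * controlled V = controlled (U * V) := by
  simp [controlled, add_mul, mul_add, ← Matrix.mul_kronecker_mul]

theorem conjTranspose_controlled (U : Matrix ι ι ℂ) : (controlled U)ᴴ = controlled Uᴴ := by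
  simp [controlled, Matrix.conjTranspose_kronecker, Matrix.conjTranspose_single]

theorem controlled_one : controlled (1 : Matrix ι ι ℂ) = 1 := by
  rw [controlled, ← Matrix.add_kronecker]
  have : Matrix.single 0 0 1 + Matrix.single 1 1 1 = (1 : Matrix (Fin 2) (Fin 2) ℂ) := by
    ext i j; fin_cases i <;> fin_cases j <;> simp
  rw [this, Matrix.one_kronecker_one]

theorem controlled_mem (U : Matrix.unitaryGroup ι ℂ) :
    controlled (U : Matrix ι ι ℂ) ∈ Matrix.unitaryGroup (Fin 2 × ι) ℂ := by
  rw [Matrix.mem_unitaryGroup_iff, Matrix.star_eq_conjTranspose, conjTranspose_controlled,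
    controlled_mul, ← Matrix.star_eq_conjTranspose, Matrix.mem_unitaryGroup_iff.1 U.2, controlled_one]

theorem one_kronecker_mem (U : Matrix.unitaryGroup ι ℂ) :
    (1 : Matrix μ μ ℂ) ⊗ₖ (U : Matrix ι ι ℂ) ∈ Matrix.unitaryGroup (μ × ι) ℂ := by
  rw [Matrix.mem_unitaryGroup_iff, Matrix.star_eq_conjTranspose, Matrix.conjTranspose_kronecker,
    ← Matrix.mul_kronecker_mul, ← Matrix.star_eq_conjTranspose (U : Matrix ι ι ℂ),
    Matrix.mem_unitaryGroup_iff.1 U.2]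
  simp

end Matrices

/-! ### From products of oracles to circuits -/

section Circuits

variable {r n a : ℕ}

/-- The oracles given to a circuit: `U_ψ`, `U_φ` and `U_in`. -/
abbrev Oracle (r n : ℕ) : Type :=
  Matrix.unitaryGroup (Fin r × Fin (2 ^ n)) ℂ × Matrix.unitaryGroup (Fin r × Fin (2 ^ n)) ℂ ×
    Matrix.unitaryGroup (Fin (2 ^ n)) ℂ

theorem run_append (Uψ Uφ : Matrix.unitaryGroup (Fin r × Fin (2 ^ n)) ℂ)
    (Uin : Matrix.unitaryGroup (Fin (2 ^ n)) ℂ) (c c' : Circuit r n a) (x : Vec (Work r n a)) :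
    Circuit.run Uψ Uφ Uin (c ++ c') x = Circuit.run Uψ Uφ Uin c' (Circuit.run Uψ Uφ Uin c x) :=
  List.foldl_append

/-- A product F * G applies G first, whereas the head of a circuit acts first, so circuits are
concatenated in reverse order. -/
theorem Implementable.exists_circuit
    {S T : Set (Oracle r n → (Vec (Work r n a) ≃ₗᵢ[ℂ] Vec (Work r n a)))}
    {N : ℕ} {F : Oracle r n → (Vec (Work r n a) ≃ₗᵢ[ℂ] Vec (Work r n a))}
    (hS : ∀ F ∈ S, ∃ g : Gate r n a, (∀ q, g.isQuery q = false) ∧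
      ∀ o x, F o x = act (g.mat o.1 o.2.1 o.2.2) x)
    (hT : ∀ F ∈ T, ∃ g : Gate r n a, ∀ o x, F o x = act (g.mat o.1 o.2.1 o.2.2) x)
    (h : Implementable S T N F) :
    ∃ circ : Circuit r n a, (∀ q, Circuit.uses q circ ≤ N) ∧
      ∀ o x, Circuit.run o.1 o.2.1 o.2.2 circ x = F o x := by
  induction h with
  | fixed V =>
    refine ⟨[.fixed (toIsometry.symm V)], fun q => by simp [Circuit.uses, Gate.isQuery], fun o x => ?_⟩
    exact act_symm_toIsometry V x
  | free hF =>
    obtain ⟨g, hg, hg'⟩ := hS _ hF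
    exact ⟨[g], fun q => by simp [Circuit.uses, hg], fun o x => (hg' o x).symm⟩
  | counted hF =>
    obtain ⟨g, hg⟩ := hT _ hF
    exact ⟨[g], fun q => List.countP_le_length, fun o x => (hg o x).symm⟩
  | mul _ _ h1 h2 =>
    obtain ⟨c1, hc1, hr1⟩ := h1
    obtain ⟨c2, hc2, hr2⟩ := h2
    refine ⟨c2 ++ c1, fun q => ?_, fun o x => ?_⟩
    · have e1 := hc1 q
      have e2 := hc2 q
      simp only [Circuit.uses, List.countP_append] at *
      omega
    · rw [run_append, hr2, hr1]
      rfl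

theorem Query.mat_mem (Uψ Uφ : Matrix.unitaryGroup (Fin r × Fin (2 ^ n)) ℂ) (q : Query) :
    q.mat Uψ Uφ ∈ Matrix.unitaryGroup (Fin 2 × (Fin r × Fin (2 ^ n))) ℂ := by
  cases q
  · exact controlled_mem Uψ
  · exact Unitary.star_mem (controlled_mem Uψ)
  · exact controlled_mem Uφ
  · exact Unitary.star_mem (controlled_mem Uφ)

/-- A query as an isometry of the registers on which it acts. -/
def queryIso (q : Query) (o : Oracle r n) :
    Vec (Fin 2 × (Fin r × Fin (2 ^ n))) ≃ₗᵢ[ℂ] Vec (Fin 2 × (Fin r × Fin (2 ^ n))) :=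
  toIsometry ⟨q.mat o.1 o.2.1, q.mat_mem o.1 o.2.1⟩

/-- The preparation of the input state as an isometry. -/
def inputIso (o : Oracle r n) :
    Vec (Fin 2 × (Fin r × Fin (2 ^ n))) ≃ₗᵢ[ℂ] Vec (Fin 2 × (Fin r × Fin (2 ^ n))) :=
  toIsometry ⟨1 ⊗ₖ (1 ⊗ₖ (o.2.2 : Matrix (Fin (2 ^ n)) (Fin (2 ^ n)) ℂ)),
    one_kronecker_mem ⟨1 ⊗ₖ (o.2.2 : Matrix (Fin (2 ^ n)) (Fin (2 ^ n)) ℂ), one_kronecker_mem o.2.2⟩⟩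

theorem queryIso_psiAdj : queryIso (r := r) (n := n) .psiAdj = (queryIso .psi)⁻¹ := by
  funext o
  simp only [Pi.inv_apply, queryIso, ← map_inv]
  rfl

theorem queryIso_phiAdj : queryIso (r := r) (n := n) .phiAdj = (queryIso .phi)⁻¹ := by
  funext o
  simp only [Pi.inv_apply, queryIso, ← map_inv]
  rfl

/-- The uses of `U_in` and its adjoint. -/
def inputSet (r n : ℕ) : Set (Oracle r n →
    (Vec (Fin 2 × (Fin r × Fin (2 ^ n))) ≃ₗᵢ[ℂ] Vec (Fin 2 × (Fin r × Fin (2 ^ n))))) :=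
  {inputIso, inputIso⁻¹}

/-- The queries. -/
def querySet (r n : ℕ) : Set (Oracle r n →
    (Vec (Fin 2 × (Fin r × Fin (2 ^ n))) ≃ₗᵢ[ℂ] Vec (Fin 2 × (Fin r × Fin (2 ^ n))))) :=
  Set.range queryIso

theorem inv_mem_inputSet : ∀ F ∈ inputSet r n, F⁻¹ ∈ inputSet r n := by
  rintro F (rfl | rfl)
  · exact Or.inr rfl
  · exact Or.inl (inv_inv _)

theorem inv_mem_querySet : ∀ F ∈ querySet r n, F⁻¹ ∈ querySet r n := by
  rintro _ ⟨q, rfl⟩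
  cases q
  · exact ⟨_, queryIso_psiAdj⟩
  · exact ⟨.psi, by rw [queryIso_psiAdj, inv_inv]⟩
  · exact ⟨_, queryIso_phiAdj⟩
  · exact ⟨.phi, by rw [queryIso_phiAdj, inv_inv]⟩

/-- Conjugation by an isometry. -/
def conjHom {E E' : Type*} [NormedAddCommGroup E] [InnerProductSpace ℂ E]
    [NormedAddCommGroup E'] [InnerProductSpace ℂ E'] (T : E ≃ₗᵢ[ℂ] E') :
    (E ≃ₗᵢ[ℂ] E) →* (E' ≃ₗᵢ[ℂ] E') where
  toFun U := (T.symm.trans U).trans T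
  map_one' := by ext x; exact T.apply_symm_apply x
  map_mul' U V := by
    ext x
    change T (U (V (T.symm x))) = T (U (T.symm (T (V (T.symm x)))))
    rw [T.symm_apply_apply]

/-- The identification of nested registers with a single ancilla register. -/
def flatten {ι I J K L : Type} [Fintype ι] [Fintype I] [Fintype J] [Fintype K] [Fintype L]
    (e : L ≃ K × J × I) : Reg K (Reg J (Reg I (Vec ι))) ≃ₗᵢ[ℂ] Vec (ι × L) where
  toFun z := WithLp.toLp 2 fun p => z (e p.2).1 (e p.2).2.1 (e p.2).2.2 p.1
  invFun y := Reg.mk fun k => Reg.mk fun j => Reg.mk fun i =>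
    WithLp.toLp 2 fun b => y (b, e.symm (k, j, i))
  map_add' z z' := by ext p; simp
  map_smul' c z := by ext p; simp
  left_inv z := by ext k j i b; simp
  right_inv y := by ext p; simp
  norm_map' z := by
    rw [← sq_eq_sq₀ (norm_nonneg _) (norm_nonneg _)]
    simp only [Reg.norm_sq_eq, PiLp.norm_sq_eq_of_L2]
    change ∑ p : ι × L, ‖z (e p.2).1 (e p.2).2.1 (e p.2).2.2 p.1‖ ^ 2 = _
    rw [Fintype.sum_prod_type_right, ← e.symm.sum_comp]
    simp only [Equiv.apply_symm_apply, Fintype.sum_prod_type]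

theorem flatten_extend {ι I J K L : Type} [Fintype ι] [Fintype I] [Fintype J] [Fintype K] [Fintype L]
    [DecidableEq ι] [DecidableEq L] (e : L ≃ K × J × I) (U : Matrix.unitaryGroup ι ℂ)
    (x : Vec (ι × L)) :
    conjHom (flatten e) (extend K (extend J (extend I (toIsometry U)))) x =
      act ((U : Matrix ι ι ℂ) ⊗ₖ (1 : Matrix L L ℂ)) x := by
  ext ⟨i, l⟩
  rw [act_kronecker_one]
  change ∑ j, (U : Matrix ι ι ℂ) i j * x (j, e.symm ((e l).1, (e l).2.1, (e l).2.2)) = _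
  simp

/-- A product of oracles that acts on nested registers is implemented by a circuit, up to the
identification of the workspaces. -/
theorem Implementable.exists_circuit_flatten {I J K : Type} [Fintype I] [Fintype J] [Fintype K]
    (e : Fin (2 ^ a) ≃ K × J × I) {N : ℕ}
    {F : Oracle r n → (Reg K (Reg J (Reg I (Vec (Fin 2 × (Fin r × Fin (2 ^ n)))))) ≃ₗᵢ[ℂ]
      Reg K (Reg J (Reg I (Vec (Fin 2 × (Fin r × Fin (2 ^ n)))))))}
    (h : Implementable
      ((fun F o => extend K (F o)) '' ((fun F o => extend J (F o)) ''
        ((fun F o => extend I (F o)) '' inputSet r n)))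
      ((fun F o => extend K (F o)) '' ((fun F o => extend J (F o)) ''
        ((fun F o => extend I (F o)) '' querySet r n))) N F)
    (V V' : Vec (Work r n a) ≃ₗᵢ[ℂ] Vec (Work r n a)) :
    ∃ circ : Circuit r n a, (∀ q, Circuit.uses q circ ≤ N) ∧
      ∀ o x, Circuit.run o.1 o.2.1 o.2.2 circ x =
        V' (flatten e (F o ((flatten e).symm (V x)))) := by
  have h' := ((Implementable.fixed V').mul (h.map (conjHom (flatten e)))).mul (.fixed V)
  rw [zero_add, add_zero] at h'
  refine (h'.exists_circuit ?_ ?_).imp fun circ hc => ⟨hc.1, fun o x => (hc.2 o x).trans rfl⟩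
  · rintro _ ⟨_, ⟨_, ⟨_, ⟨_, (rfl | rfl), rfl⟩, rfl⟩, rfl⟩, rfl⟩
    · exact ⟨.input, fun q => rfl, fun o x => flatten_extend e _ x⟩
    · refine ⟨.inputAdj, fun q => rfl, fun o x => ?_⟩
      simp only [Pi.inv_apply, inputIso, ← map_inv toIsometry]
      rw [flatten_extend]
      congr 2
      rw [Matrix.UnitaryGroup.inv_val, Matrix.star_eq_conjTranspose]
      simp [Matrix.conjTranspose_kronecker]
  · rintro _ ⟨_, ⟨_, ⟨_, ⟨_, ⟨q, rfl⟩, rfl⟩, rfl⟩, rfl⟩, rfl⟩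
    exact ⟨.query q, fun o x => flatten_extend e _ x⟩

end Circuits

/-! ### The block encoding of the Procrustes matrix -/

section Encoding

variable {D E : Type*} [NormedAddCommGroup D] [InnerProductSpace ℂ D] [FiniteDimensional ℂ D]
  [NormedAddCommGroup E] [InnerProductSpace ℂ E]

/-- The hypothesis says that d is the adjoint of f applied to z, so the projection can be read off
from matrix elements. -/
theorem starProjection_range (f : D →ₗᵢ[ℂ] E) {z : E} {d : D}
    (h : ∀ y, inner ℂ (f y) z = inner ℂ y d) :
    (LinearMap.range f.toLinearMap).starProjection z = f d := by
  apply Submodule.eq_starProjection_of_mem_of_inner_eq_zero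
  · exact LinearMap.mem_range_self f.toLinearMap d
  · rintro _ ⟨y, rfl⟩
    rw [← inner_conj_symm, map_eq_zero, inner_sub_right, LinearIsometry.coe_toLinearMap, h,
      f.inner_map_map, sub_self]

variable [FiniteDimensional ℂ E]

theorem starProjection_span_range {ι : Type*} [Fintype ι] {e : ι → E} (he : Orthonormal ℂ e) (z : E) :
    (Submodule.span ℂ (Set.range e)).starProjection z = ∑ i, inner ℂ (e i) z • e i := by
  classical
  apply Submodule.eq_starProjection_of_mem_orthogonal
  · exact Submodule.sum_mem _ fun i _ => Submodule.smul_mem _ _ (Submodule.subset_span ⟨i, rfl⟩)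
  · rw [Submodule.mem_orthogonal]
    intro u hu
    induction hu using Submodule.span_induction with
    | mem x hx =>
      obtain ⟨i, rfl⟩ := hx
      rw [inner_sub_right, he.inner_right_fintype, sub_self]
    | zero => simp
    | add x y _ _ hx hy => rw [inner_add_left, hx, hy, add_zero]
    | smul c x _ hx => rw [inner_smul_left, hx, mul_zero]

theorem sum_sq_inv_sqrt_two : ∑ _j : Fin 2, (1 / √2 : ℝ) ^ 2 = 1 := by
  simp

/-- The product of `Q`, the projector onto a subspace, and `P⁻¹`, as a combination of two
unitaries. -/
def encode (P Q : E ≃ₗᵢ[ℂ] E) (K : Submodule ℂ E) : Reg (Fin 2) E ≃ₗᵢ[ℂ] Reg (Fin 2) E :=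
  extend (Fin 2) Q * select ![1, K.reflection] * (extend (Fin 2) P)⁻¹

/-- A reflection is its own inverse, so inversion only exchanges P and Q; hence the inverse of the
encoding of A/r encodes A†/r. -/
theorem inv_encode (P Q : E ≃ₗᵢ[ℂ] E) (K : Submodule ℂ E) :
    (encode P Q K)⁻¹ = encode Q P K := by
  have h : (select ![1, K.reflection])⁻¹ = select ![1, K.reflection] := by
    rw [← map_inv]
    congr 1
    funext j
    fin_cases j
    · simp
    · exact K.reflection_inv
  simp only [encode, mul_inv_rev, h, inv_inv, mul_assoc]

/-- The average of 1 and the reflection 2Π − 1 is Π. -/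
theorem starProjection_encode (P Q : E ≃ₗᵢ[ℂ] E) (K L : Submodule ℂ E) (y : E) :
    (L.map (attach (fun _ : Fin 2 => (1 / √2 : ℝ)) sum_sq_inv_sqrt_two).toLinearMap).starProjection
      (encode P Q K (attach (fun _ : Fin 2 => (1 / √2 : ℝ)) sum_sq_inv_sqrt_two y)) =
    attach (fun _ : Fin 2 => (1 / √2 : ℝ)) sum_sq_inv_sqrt_two
      (L.starProjection (Q (K.starProjection (P⁻¹ y)))) := by
  have h : encode P Q K = select fun j => Q * ![1, K.reflection] j * P⁻¹ := by
    simp only [encode, extend, MonoidHom.comp_apply, ← map_inv, ← map_mul]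
    rfl
  rw [h, starProjection_select_attach]
  congr 1
  have h2 : ((1 / √2 * (1 / √2) : ℝ) : ℂ) = 1 / 2 := by
    rw [div_mul_div_comm, Real.mul_self_sqrt (by norm_num)]; norm_num
  simp only [Fin.sum_univ_two, h2, mul_apply, Matrix.cons_val_zero, Matrix.cons_val_one,
    Submodule.reflection_apply, map_sub, map_nsmul, LinearIsometryEquiv.coe_one, id_eq]
  rw [← Nat.cast_smul_eq_nsmul ℂ]
  push_cast
  module

/-- If `P` and `Q` prepare the families `ψ` and `φ`, then `encode P Q` is a block encoding of
`(1 / r) ∑ i, |φ i⟩⟨ψ i|`. -/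
theorem starProjection_encode_eq {r : ℕ} [NeZero r] (f : D →ₗᵢ[ℂ] E) {e : Fin r → E}
    (he : Orthonormal ℂ e) {P Q : E ≃ₗᵢ[ℂ] E} {ψ φ : Fin r → D}
    (hP : ∀ i y, inner ℂ (f y) (P (e i)) = ((1 / √r : ℝ) : ℂ) * inner ℂ y (ψ i))
    (hQ : ∀ i y, inner ℂ (f y) (Q (e i)) = ((1 / √r : ℝ) : ℂ) * inner ℂ y (φ i)) (y : D) :
    ((LinearMap.range f.toLinearMap).map
      (attach (fun _ : Fin 2 => (1 / √2 : ℝ)) sum_sq_inv_sqrt_two).toLinearMap).starProjection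
      (encode P Q (Submodule.span ℂ (Set.range e))
        (attach (fun _ : Fin 2 => (1 / √2 : ℝ)) sum_sq_inv_sqrt_two (f y))) =
    attach (fun _ : Fin 2 => (1 / √2 : ℝ)) sum_sq_inv_sqrt_two
      (f (((1 / r : ℝ) : ℂ) • ∑ i, inner ℂ (ψ i) y • φ i)) := by
  rw [starProjection_encode, starProjection_span_range he]
  congr 1
  have hr : ((1 / √r : ℝ) : ℂ) * ((1 / √r : ℝ) : ℂ) = ((1 / r : ℝ) : ℂ) := by
    rw [← Complex.ofReal_mul, div_mul_div_comm, Real.mul_self_sqrt (by positivity), one_mul]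
  apply starProjection_range
  intro y'
  -- Each of P and Q contributes an overlap 1/√r with the uniform superposition, which is the origin
  -- of the factor 1/r.
  simp only [map_sum, map_smul, inner_sum, inner_smul_right, inner_inv_apply, hQ, Finset.mul_sum]
  refine Finset.sum_congr rfl fun i _ => ?_
  rw [← inner_conj_symm, hP, map_mul, Complex.conj_ofReal, inner_conj_symm, ← hr]
  ring

end Encoding

/-! ### Singular values of the Procrustes matrix and of its block encoding -/

section SingularValues

variable {r N : ℕ} {ψ φ : Fin r → Vec (Fin N)}

theorem SVD.sum_inner_smul (S : SVD (procrustesMatrix ψ φ)) (y : Vec (Fin N)) :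
    ∑ i, inner ℂ (ψ i) y • φ i = ∑ j, (S.σ j : ℂ) • inner ℂ (S.v j) y • S.w j := by
  have h := congrArg (fun M => act M y) S.eq_sum
  simpa only [procrustesMatrix, act_sum, act_smul, act_outer] using h

theorem SVD.sum_inner_smul_adjoint (S : SVD (procrustesMatrix ψ φ)) (y : Vec (Fin N)) :
    ∑ i, inner ℂ (φ i) y • ψ i = ∑ j, (S.σ j : ℂ) • inner ℂ (S.w j) y • S.v j := by
  have h := congrArg (fun M => act Mᴴ y) S.eq_sum
  simpa only [procrustesMatrix, Matrix.conjTranspose_sum, Matrix.conjTranspose_smul,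
    conjTranspose_outer, act_sum, act_smul, act_outer, Complex.star_def, Complex.conj_ofReal] using h

theorem SVD.act_polar (S : SVD (procrustesMatrix ψ φ)) (y : Vec (Fin N)) :
    act S.polar y = ∑ j, inner ℂ (S.v j) y • S.w j := by
  simp only [SVD.polar, act_sum, act_outer]

theorem norm_sq_sum_smul {E ι : Type*} [NormedAddCommGroup E] [InnerProductSpace ℂ E] [Fintype ι]
    {w : ι → E} (hw : Orthonormal ℂ w) (c : ι → ℂ) : ‖∑ j, c j • w j‖ ^ 2 = ∑ j, ‖c j‖ ^ 2 := by
  rw [norm_sq_eq_re_inner (𝕜 := ℂ), hw.inner_sum]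
  simp [← Complex.normSq_eq_conj_mul_self, Complex.normSq_eq_norm_sq, -Complex.ofReal_pow]

/-- Parseval in the right singular vectors. The hypothesis that the row space is the span of the
input states enters here. -/
theorem SVD.overlap_eq (S : SVD (procrustesMatrix ψ φ))
    (h : S.row = Submodule.span ℂ (Set.range ψ)) (y : Vec (Fin N)) :
    overlap ψ y ^ 2 = ∑ j, ‖inner ℂ (S.v j) y‖ ^ 2 := by
  simp only [overlap, ← h]
  change ‖(Submodule.span ℂ (Set.range S.v)).starProjection y‖ ^ 2 = _
  rw [starProjection_span_range S.v_orthonormal, norm_sq_sum_smul S.v_orthonormal]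

theorem overlap_nonneg (y : Vec (Fin N)) : 0 ≤ overlap ψ y := norm_nonneg _

theorem SVD.norm_act_polar (S : SVD (procrustesMatrix ψ φ))
    (h : S.row = Submodule.span ℂ (Set.range ψ)) (y : Vec (Fin N)) :
    ‖act S.polar y‖ = overlap ψ y := by
  rw [← sq_eq_sq₀ (norm_nonneg _) (overlap_nonneg y), S.overlap_eq h, S.act_polar,
    norm_sq_sum_smul S.w_orthonormal]

theorem SVD.norm_idealState (S : SVD (procrustesMatrix ψ φ))
    (h : S.row = Submodule.span ℂ (Set.range ψ)) {y : Vec (Fin N)} (hy : 0 < overlap ψ y) :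
    ‖idealState S y‖ = 1 := by
  rw [idealState, norm_smul, S.norm_act_polar h, Complex.norm_real, Real.norm_eq_abs,
    abs_of_pos (by positivity), one_div, inv_mul_cancel₀ hy.ne']

theorem SVD.inv_le_σ (S : SVD (procrustesMatrix ψ φ)) {κ : ℝ} (hκ : 0 < κ)
    (h : 1 / S.sigmaMin ≤ κ) (j : Fin S.rank) : 1 / κ ≤ S.σ j := by
  have hle : S.sigmaMin ≤ S.σ j := ciInf_le (Set.finite_range _).bddBelow j
  -- Positivity of `sigmaMin` needs a singular value: for rank zero the infimum is 0 by default.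
  have : Nonempty (Fin S.rank) := ⟨j⟩
  obtain ⟨i, hi⟩ := exists_eq_ciInf_of_finite (f := S.σ)
  have hpos : 0 < S.sigmaMin := by
    rw [SVD.sigmaMin, ← hi]; exact S.σ_pos i
  refine le_trans ?_ hle
  rw [div_le_iff₀ hpos] at h
  rw [div_le_iff₀ hκ]
  linarith

/-- The singular pairs of a block encoding of `A / r`. -/
theorem SVD.isSingularPair (S : SVD (procrustesMatrix ψ φ)) {E : Type*} [NormedAddCommGroup E]
    [InnerProductSpace ℂ E] [FiniteDimensional ℂ E] (f : Vec (Fin N) →ₗᵢ[ℂ] E) {U : E ≃ₗᵢ[ℂ] E}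
    {L : Submodule ℂ E} (hL : ∀ y, f y ∈ L)
    (h : ∀ y, L.starProjection (U (f y)) = f (((1 / r : ℝ) : ℂ) • ∑ i, inner ℂ (ψ i) y • φ i))
    (h' : ∀ y, L.starProjection (U⁻¹ (f y)) = f (((1 / r : ℝ) : ℂ) • ∑ i, inner ℂ (φ i) y • ψ i))
    (j : Fin S.rank) : IsSingularPair U L L (S.σ j / r) (f (S.v j)) (f (S.w j)) where
  left_mem := hL _
  right_mem := hL _
  proj_right := by
    classical
    rw [h, S.sum_inner_smul, ← map_smul]
    simp only [orthonormal_iff_ite.1 S.v_orthonormal, ite_smul, one_smul, zero_smul, smul_ite,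
      smul_zero, Finset.sum_ite_eq', Finset.mem_univ, if_true, smul_smul]
    congr 2
    push_cast; ring
  proj_left := by
    classical
    rw [h', S.sum_inner_smul_adjoint, ← map_smul]
    simp only [orthonormal_iff_ite.1 S.w_orthonormal, ite_smul, one_smul, zero_smul, smul_ite,
      smul_zero, Finset.sum_ite_eq', Finset.mem_univ, if_true, smul_smul]
    congr 2
    push_cast; ring

/-- Vectors orthogonal to the row space form singular pairs with singular value zero. -/
theorem SVD.isSingularPair_zero (S : SVD (procrustesMatrix ψ φ)) {E : Type*} [NormedAddCommGroup E]
    [InnerProductSpace ℂ E] [FiniteDimensional ℂ E] (f : Vec (Fin N) →ₗᵢ[ℂ] E) {U : E ≃ₗᵢ[ℂ] E}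
    {L : Submodule ℂ E} (hL : ∀ y, f y ∈ L)
    (h : ∀ y, L.starProjection (U (f y)) = f (((1 / r : ℝ) : ℂ) • ∑ i, inner ℂ (ψ i) y • φ i))
    {y : Vec (Fin N)} (hy : ∀ j, inner ℂ (S.v j) y = 0) : IsSingularPair U L L 0 (f y) 0 where
  left_mem := hL _
  right_mem := zero_mem _
  proj_right := by rw [h, S.sum_inner_smul]; simp [hy]
  proj_left := by simp

/-- Singular value transformation of the block encoding. -/
theorem SVD.starProjection_selectGrover (S : SVD (procrustesMatrix ψ φ)) {E : Type*}
    [NormedAddCommGroup E]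
    [InnerProductSpace ℂ E] [FiniteDimensional ℂ E] (f : Vec (Fin N) →ₗᵢ[ℂ] E) {U : E ≃ₗᵢ[ℂ] E}
    {L : Submodule ℂ E} (hL : ∀ y, f y ∈ L)
    (h : ∀ y, L.starProjection (U (f y)) = f (((1 / r : ℝ) : ℂ) • ∑ i, inner ℂ (ψ i) y • φ i))
    (h' : ∀ y, L.starProjection (U⁻¹ (f y)) = f (((1 / r : ℝ) : ℂ) • ∑ i, inner ℂ (φ i) y • ψ i))
    {θ : Fin S.rank → ℝ} (hθ : ∀ j, Real.sin (θ j) = S.σ j / r)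
    {J : Type*} [Fintype J] (d : ℕ) (idx : J → ℕ)
    (hd : ∀ j, idx j ≤ d) (p q : J → ℝ)
    (hp : ∑ j, p j ^ 2 = 1) (hq : ∑ j, q j ^ 2 = 1) (y : Vec (Fin N)) :
    (L.map (attach q hq).toLinearMap).starProjection (selectGrover U L L d idx (attach p hp (f y))) =
      attach q hq (f (∑ j, ((∑ k, q k * p k * Real.sin ((2 * idx k + 1) * θ j) : ℝ) : ℂ) •
        inner ℂ (S.v j) y • S.w j)) := by
  -- The component orthogonal to the row space has singular value sin 0 = 0, which every sine in the
  -- average keeps at zero.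
  set y₀ := y - ∑ j, inner ℂ (S.v j) y • S.v j with hy₀
  have h0 : ∀ j, inner ℂ (S.v j) y₀ = 0 := fun j => by
    rw [hy₀, inner_sub_right, S.v_orthonormal.inner_right_fintype, sub_self]
  have hy : y = ∑ j, inner ℂ (S.v j) y • S.v j + y₀ := by rw [hy₀]; abel
  have hs0 : IsSingularPair U L L (Real.sin 0) (f y₀) 0 := by
    rw [Real.sin_zero]; exact S.isSingularPair_zero f hL h h0
  have hsj : ∀ j, IsSingularPair U L L (Real.sin (θ j)) (f (S.v j)) (f (S.w j)) := fun j => by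
    rw [hθ]; exact S.isSingularPair f hL h h' j
  conv_lhs => rw [hy]
  simp only [map_add, map_sum, map_smul, hs0.starProjection_selectGrover d idx hd p q hp hq,
    (hsj _).starProjection_selectGrover d idx hd p q hp hq, map_zero, smul_zero, add_zero]
  refine Finset.sum_congr rfl fun j _ => smul_comm _ _ _

end SingularValues

/-! ### Approximation of the sign function of the singular values -/

/-- The amplitudes `ρ √(c j)` and `√(1 - ρ²) √(c j)`, where `c j` are the normalized coefficients of
the square wave. -/
def amplitude (M : ℕ) (ρ : ℝ) (k : Fin 2 × Fin M) : ℝ :=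
  (if k.1 = 0 then ρ else √(1 - ρ ^ 2)) * √(1 / ((2 * (k.2 : ℝ) + 1) * weight M))

/-- The amplitudes for ρ = 1 vanish on the branch `k.1 = 1`, so that branch only normalizes the
amplitudes for ρ. Using ρ on one side thus scales the compression by an adjustable factor. -/
theorem amplitude_mul_amplitude_one {M : ℕ} (hM : 0 < M) (ρ : ℝ) (k : Fin 2 × Fin M) :
    amplitude M ρ k * amplitude M 1 k =
      if k.1 = 0 then ρ / weight M * (1 / (2 * (k.2 : ℝ) + 1)) else 0 := by
  have hw := one_le_weight hM
  have : 0 ≤ 1 / ((2 * (k.2 : ℝ) + 1) * weight M) := by positivity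
  unfold amplitude
  split_ifs with h
  · rw [mul_mul_mul_comm, Real.mul_self_sqrt this]
    field_simp
  · simp

theorem sum_sq_amplitude {M : ℕ} (hM : 0 < M) {ρ : ℝ} (hρ0 : 0 ≤ ρ) (hρ1 : ρ ≤ 1) :
    ∑ k, amplitude M ρ k ^ 2 = 1 := by
  have hw := one_le_weight hM
  have h1 : ∀ j : Fin M, √(1 / ((2 * (j : ℝ) + 1) * weight M)) ^ 2 =
      1 / (2 * (j : ℝ) + 1) * (1 / weight M) := fun j => by
    rw [Real.sq_sqrt (by positivity)]; field_simp
  have h2 : ∑ j : Fin M, 1 / (2 * (j : ℝ) + 1) = weight M :=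
    Fin.sum_univ_eq_sum_range (fun j : ℕ => 1 / (2 * (j : ℝ) + 1)) M
  simp only [amplitude, mul_pow, Fintype.sum_prod_type, Fin.sum_univ_two, if_true, h1,
    ← Finset.mul_sum, ← Finset.sum_mul, h2, one_ne_zero, if_false]
  rw [Real.sq_sqrt (by nlinarith)]
  field_simp
  ring

theorem sum_amplitude_mul_sin {M : ℕ} (hM : 0 < M) (ρ θ : ℝ) :
    ∑ k : Fin 2 × Fin M, amplitude M ρ k * amplitude M 1 k * Real.sin ((2 * (k.2 : ℕ) + 1) * θ) =
      ρ / weight M * squareWave M θ := by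
  have h2 : ∑ j : Fin M, ρ / weight M * (1 / (2 * (j : ℝ) + 1)) * Real.sin ((2 * (j : ℕ) + 1) * θ) =
      ρ / weight M * squareWave M θ := by
    rw [squareWave, Finset.mul_sum, ← Fin.sum_univ_eq_sum_range
      (fun j : ℕ => ρ / weight M * (Real.sin ((2 * (j : ℝ) + 1) * θ) / (2 * (j : ℝ) + 1)))]
    exact Finset.sum_congr rfl fun j _ => by ring
  simp only [amplitude_mul_amplitude_one hM, Fintype.sum_prod_type, Fin.sum_univ_two, if_true,
    one_ne_zero, if_false, zero_mul, Finset.sum_const_zero, add_zero, h2]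

/-- The triangle inequality through Y/t: rescaling from t to ‖Y‖ and replacing Y/t by u each cost at
most δ. -/
theorem norm_normalize_sub_le {E : Type*} [NormedAddCommGroup E] [NormedSpace ℂ E] {Y u : E}
    (hu : ‖u‖ = 1) (hY : Y ≠ 0) {t δ : ℝ} (ht : 0 < t) (h : ‖Y - (t : ℂ) • u‖ ≤ δ * t) :
    ‖((1 / ‖Y‖ : ℝ) : ℂ) • Y - u‖ ≤ 2 * δ := by
  have hY' : 0 < ‖Y‖ := norm_pos_iff.2 hY
  have h1 : ‖((1 / ‖Y‖ : ℝ) : ℂ) • Y - ((1 / t : ℝ) : ℂ) • Y‖ ≤ δ := by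
    rw [← sub_smul, norm_smul, ← Complex.ofReal_sub, Complex.norm_real, Real.norm_eq_abs]
    have e : |1 / ‖Y‖ - 1 / t| * ‖Y‖ = |t - ‖Y‖| / t := by
      rw [div_sub_div _ _ hY'.ne' ht.ne', abs_div, abs_of_pos (by positivity : 0 < ‖Y‖ * t)]
      field_simp
    rw [e, div_le_iff₀ ht]
    refine le_trans ?_ h
    have := abs_norm_sub_norm_le Y ((t : ℂ) • u)
    rw [norm_smul, hu, Complex.norm_real, Real.norm_eq_abs, abs_of_pos ht, mul_one, abs_sub_comm] at this
    exact this
  have h2 : ‖((1 / t : ℝ) : ℂ) • Y - u‖ ≤ δ := by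
    have e : ((1 / t : ℝ) : ℂ) • Y - u = ((1 / t : ℝ) : ℂ) • (Y - (t : ℂ) • u) := by
      rw [smul_sub, smul_smul, ← Complex.ofReal_mul, one_div_mul_cancel ht.ne', Complex.ofReal_one,
        one_smul]
    rw [e, norm_smul, Complex.norm_real, Real.norm_eq_abs, abs_of_pos (by positivity), one_div,
      inv_mul_le_iff₀ ht, mul_comm]
    exact h
  calc _ = ‖(((1 / ‖Y‖ : ℝ) : ℂ) • Y - ((1 / t : ℝ) : ℂ) • Y) + (((1 / t : ℝ) : ℂ) • Y - u)‖ := by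
        congr 1; abel
    _ ≤ _ := (norm_add_le _ _).trans (by linarith)

/-! ### Amplifying an unknown amplitude to nearly one -/

section FixedPoint

variable {E : Type*} [NormedAddCommGroup E] [InnerProductSpace ℂ E] [FiniteDimensional ℂ E]

/-- Fixed-point amplitude amplification: the amplitude `s` of `w` is unknown, but at least `s₀`. -/
theorem norm_grover_selectGrover_sub_le {B : E ≃ₗᵢ[ℂ] E} {L : Submodule ℂ E} {e w : E}
    (he : ‖e‖ = 1) (hw : w ∈ L) (hw1 : ‖w‖ = 1) {s s₀ δ ρ : ℝ}
    (h : L.starProjection (B e) = (s : ℂ) • w) (hs₀ : 0 < s₀) (hs : s₀ ≤ s)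
    {k m : ℕ} (hk : 0 < k) (hm : 1 ≤ m) (hδ : 8 / (Real.pi * (2 * k : ℕ) * s₀) ≤ δ) (hδ' : δ ≤ 1 / 2)
    (hρ : ρ / weight (2 * k) * (Real.pi / 4) = Real.sin (Real.pi / (2 * (2 * m + 1))))
    (hp : ∑ j, amplitude (2 * k) 1 j ^ 2 = 1) (hq : ∑ j, amplitude (2 * k) ρ j ^ 2 = 1)
    {W : Reg (Fin 2 × Fin (2 * k)) E ≃ₗᵢ[ℂ] Reg (Fin 2 × Fin (2 * k)) E}
    (hW : W = selectGrover B (Submodule.span ℂ {e}) L (2 * k) (fun j => (j.2 : ℕ)))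
    {e' : Reg (Fin 2 × Fin (2 * k)) E} (hee' : e' = attach (amplitude (2 * k) 1) hp e) :
    ‖(W * grover W (Submodule.span ℂ {e'}) (L.map (attach (amplitude (2 * k) ρ) hq).toLinearMap) ^ m) e' -
      attach (amplitude (2 * k) ρ) hq w‖ ≤ Real.pi * δ := by
  have hpi := Real.pi_pos
  have hk2 : 0 < 2 * k := by omega
  have he' : ‖e'‖ = 1 := by rw [hee', LinearIsometry.norm_map, he]
  have hw' : ‖attach (amplitude (2 * k) ρ) hq w‖ = 1 := by rw [LinearIsometry.norm_map, hw1]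
  have hwm : attach (amplitude (2 * k) ρ) hq w ∈
      L.map (attach (amplitude (2 * k) ρ) hq).toLinearMap := Submodule.mem_map_of_mem hw
  have hpair := isSingularPair_span_singleton he hw hw1 h
  have hs1 : s ≤ 1 := (le_abs_self s).trans (hpair.norm_le_one he hw1)
  set θ := Real.arcsin s with hθ
  have hsin : Real.sin θ = s := Real.sin_arcsin (by linarith) hs1
  have hθ0 : 0 < θ := Real.arcsin_pos.2 (by linarith)
  rw [← hsin] at hpair
  have h2 := hpair.starProjection_selectGrover (2 * k) (fun j : Fin 2 × Fin (2 * k) => (j.2 : ℕ))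
    (fun j => j.2.2.le) _ _ hp hq
  rw [sum_amplitude_mul_sin hk2, ← hW, ← hee'] at h2
  -- The square wave replaces the unknown s by s₂, which is close to ρ/Λ · π/4 whatever s ≥ s₀ is.
  set s₂ := ρ / weight (2 * k) * squareWave (2 * k) θ with hs₂
  have hpair2 := isSingularPair_span_singleton he' hwm hw' h2
  have habs := hpair2.norm_le_one he' hw'
  have hsin2 : Real.sin (Real.arcsin s₂) = s₂ :=
    Real.sin_arcsin (abs_le.1 habs).1 (abs_le.1 habs).2
  rw [← hsin2] at hpair2
  have hfin := hpair2.proj_grover_pow m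
  have hdist := norm_sub_sq_of_proj (by rw [LinearIsometryEquiv.norm_map, LinearIsometryEquiv.norm_map, he'])
    hwm hw' hfin
  have hS := abs_squareWave_sub_le hk hθ0 (Real.arcsin_le_pi_div_two s)
  rw [hsin] at hS
  have hsm : 0 < Real.sin (Real.pi / (2 * (2 * m + 1))) := by
    apply Real.sin_pos_of_pos_of_lt_pi (by positivity)
    rw [div_lt_iff₀ (by positivity)]
    nlinarith [(Nat.cast_nonneg m : (0 : ℝ) ≤ m)]
  have hρ0 : 0 < ρ / weight (2 * k) := by
    rw [← hρ] at hsm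
    exact pos_of_mul_pos_left hsm (by positivity)
  have hclose : |s₂ - Real.sin (Real.pi / (2 * (2 * m + 1)))| ≤
      δ * Real.sin (Real.pi / (2 * (2 * m + 1))) := by
    -- The error is needed relative to the target amplitude: dividing 2/(2k s₀) by π/4 explains the
    -- constant 8/π in the hypothesis on δ.
    rw [← hρ, hs₂, ← mul_sub, abs_mul, abs_of_pos hρ0, mul_left_comm]
    refine mul_le_mul_of_nonneg_left (hS.trans ?_) hρ0.le
    have hk' : (0 : ℝ) < (2 * k : ℕ) := by exact_mod_cast hk2
    calc 2 / ((2 * k : ℕ) * s) ≤ 2 / ((2 * k : ℕ) * s₀) := by gcongr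
      _ = 8 / (Real.pi * (2 * k : ℕ) * s₀) * (Real.pi / 4) := by field_simp; norm_num
      _ ≤ _ := by gcongr
  have hb := one_sub_sin_mul_arcsin_le hm hδ' hclose
  have hδ0 : 0 ≤ δ := le_trans (by positivity) hδ
  refine (sq_le_sq₀ (norm_nonneg _) (by positivity)).1 ?_
  rw [mul_apply]
  exact hdist.le.trans hb

/-- Half of ε pays for the amplification, with δ = ε/(2π), and half for the distance of the
amplified vector w from the desired w'. -/
theorem norm_grover_selectGrover_sub_le_of_le {B : E ≃ₗᵢ[ℂ] E} {L : Submodule ℂ E} {e w w' : E}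
    (he : ‖e‖ = 1) (hw : w ∈ L) (hw1 : ‖w‖ = 1) {s s₀ ε ρ : ℝ}
    (h : L.starProjection (B e) = (s : ℂ) • w) (hs₀ : 0 < s₀) (hs : s₀ ≤ s)
    {k m : ℕ} (hk : 0 < k) (hm : 1 ≤ m) (hε : 8 / (Real.pi * (2 * k : ℕ) * s₀) ≤ ε / (2 * Real.pi))
    (hε' : ε ≤ 2) (hww' : ‖w - w'‖ ≤ ε / 2)
    (hρ : ρ / weight (2 * k) * (Real.pi / 4) = Real.sin (Real.pi / (2 * (2 * m + 1))))
    (hp : ∑ j, amplitude (2 * k) 1 j ^ 2 = 1) (hq : ∑ j, amplitude (2 * k) ρ j ^ 2 = 1)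
    {W : Reg (Fin 2 × Fin (2 * k)) E ≃ₗᵢ[ℂ] Reg (Fin 2 × Fin (2 * k)) E}
    (hW : W = selectGrover B (Submodule.span ℂ {e}) L (2 * k) (fun j => (j.2 : ℕ))) :
    ‖(W * grover W (Submodule.span ℂ {attach (amplitude (2 * k) 1) hp e})
        (L.map (attach (amplitude (2 * k) ρ) hq).toLinearMap) ^ m)
        (attach (amplitude (2 * k) 1) hp e) - attach (amplitude (2 * k) ρ) hq w'‖ ≤ ε := by
  have hpi := Real.pi_gt_three
  have hfix := norm_grover_selectGrover_sub_le he hw hw1 h hs₀ hs hk hm hε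
    (by rw [div_le_iff₀ (by positivity)]; linarith) hρ hp hq hW rfl
  have hdist : ‖attach (amplitude (2 * k) ρ) hq w - attach (amplitude (2 * k) ρ) hq w'‖ ≤ ε / 2 := by
    rwa [← map_sub, LinearIsometry.norm_map]
  refine ((norm_sub_le_norm_sub_add_norm_sub _ _ _).trans (add_le_add hfix hdist)).trans_eq ?_
  field_simp
  ring

end FixedPoint

/-! ### From the square wave to the polar isometry -/

section Transform

variable {r N : ℕ} {ψ φ : Fin r → Vec (Fin N)}

/-- The transformation of the singular values of `A / r` by the square wave approximates the polar
isometry on the row space. -/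
theorem SVD.exists_starProjection_eq [NeZero r] (S : SVD (procrustesMatrix ψ φ))
    (hrow : S.row = Submodule.span ℂ (Set.range ψ)) {E : Type*} [NormedAddCommGroup E]
    [InnerProductSpace ℂ E] [FiniteDimensional ℂ E] (f : Vec (Fin N) →ₗᵢ[ℂ] E) {U : E ≃ₗᵢ[ℂ] E}
    {L : Submodule ℂ E} (hL : ∀ y, f y ∈ L)
    (h : ∀ y, L.starProjection (U (f y)) = f (((1 / r : ℝ) : ℂ) • ∑ i, inner ℂ (ψ i) y • φ i))
    (h' : ∀ y, L.starProjection (U⁻¹ (f y)) = f (((1 / r : ℝ) : ℂ) • ∑ i, inner ℂ (φ i) y • ψ i))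
    {κ δ : ℝ} (hκ : 0 < κ) (hσ : 1 / S.sigmaMin ≤ κ) {k : ℕ} (hk : 0 < k)
    (hδ : 8 * (r * κ) / (Real.pi * (2 * k : ℕ)) ≤ δ)
    (hp : ∑ j, amplitude (2 * k) 1 j ^ 2 = 1) {x : Vec (Fin N)} (hx : 0 < overlap ψ x) :
    ∃ Y : Vec (Fin N),
      (L.map (attach (amplitude (2 * k) 1) hp).toLinearMap).starProjection
        (selectGrover U L L (2 * k) (fun j : Fin 2 × Fin (2 * k) => (j.2 : ℕ))
          (attach (amplitude (2 * k) 1) hp (f x))) = attach (amplitude (2 * k) 1) hp (f Y) ∧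
      ‖Y - ((Real.pi / 4 / weight (2 * k) * overlap ψ x : ℝ) : ℂ) • idealState S x‖ ≤
        δ * (Real.pi / 4 / weight (2 * k) * overlap ψ x) := by
  have hpi := Real.pi_pos
  have hk2 : 0 < 2 * k := by omega
  have hw := one_le_weight hk2
  have hr : (0 : ℝ) < r := by exact_mod_cast NeZero.pos r
  have hs : ∀ j, S.σ j / r ≤ 1 := fun j =>
    (le_abs_self _).trans ((S.isSingularPair f hL h h' j).norm_le_one
      (by rw [f.norm_map, S.v_orthonormal.1]) (by rw [f.norm_map, S.w_orthonormal.1]))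
  have hs0 : ∀ j, 0 < S.σ j / r := fun j => div_pos (S.σ_pos j) hr
  have hsin : ∀ j, Real.sin (Real.arcsin (S.σ j / r)) = S.σ j / r := fun j =>
    Real.sin_arcsin (by linarith [hs0 j]) (hs j)
  refine ⟨_, S.starProjection_selectGrover f hL h h' hsin (2 * k) _ (fun j => j.2.2.le) _ _ hp hp x, ?_⟩
  simp only [sum_amplitude_mul_sin hk2]
  have hid : ((Real.pi / 4 / weight (2 * k) * overlap ψ x : ℝ) : ℂ) • idealState S x =
      ∑ j, ((Real.pi / 4 / weight (2 * k) : ℝ) : ℂ) • inner ℂ (S.v j) x • S.w j := by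
    rw [idealState, smul_smul, ← Complex.ofReal_mul, S.act_polar, ← Finset.smul_sum]
    congr 2
    field_simp
  rw [hid, ← Finset.sum_sub_distrib]
  simp only [smul_smul, ← sub_smul, ← sub_mul, ← Complex.ofReal_sub]
  have hk' : (0 : ℝ) < (2 * k : ℕ) := by exact_mod_cast hk2
  have hδ0 : 0 ≤ δ := le_trans (by positivity) hδ
  refine (sq_le_sq₀ (norm_nonneg _) (by positivity)).1 ?_
  -- The errors point along the orthonormal vectors w j, so a uniform bound on the coefficients
  -- suffices, with no loss in the rank.
  rw [norm_sq_sum_smul S.w_orthonormal, ← mul_assoc, mul_pow, S.overlap_eq hrow, Finset.mul_sum]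
  refine Finset.sum_le_sum fun j _ => ?_
  rw [norm_mul, mul_pow]
  refine mul_le_mul_of_nonneg_right ?_ (by positivity)
  rw [Complex.norm_real, Real.norm_eq_abs]
  refine pow_le_pow_left₀ (abs_nonneg _) ?_ 2
  have e : 1 / weight (2 * k) * squareWave (2 * k) (Real.arcsin (S.σ j / r)) -
      Real.pi / 4 / weight (2 * k) =
      1 / weight (2 * k) * (squareWave (2 * k) (Real.arcsin (S.σ j / r)) - Real.pi / 4) := by
    ring
  rw [e, abs_mul, abs_of_pos (by positivity)]
  have hS := abs_squareWave_sub_le hk (Real.arcsin_pos.2 (hs0 j)) (Real.arcsin_le_pi_div_two _)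
  rw [hsin] at hS
  have hlow : 1 / (r * κ) ≤ S.σ j / r := by
    have := S.inv_le_σ hκ hσ j
    calc 1 / (r * κ) = 1 / κ / r := by field_simp
      _ ≤ _ := by gcongr
  have hub : 2 / ((2 * k : ℕ) * (S.σ j / r)) ≤ δ * (Real.pi / 4) := by
    calc 2 / ((2 * k : ℕ) * (S.σ j / r)) ≤ 2 / ((2 * k : ℕ) * (1 / (r * κ))) := by gcongr
      _ = 8 * (r * κ) / (Real.pi * (2 * k : ℕ)) * (Real.pi / 4) := by field_simp; norm_num
      _ ≤ _ := by gcongr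
  calc 1 / weight (2 * k) * |squareWave (2 * k) (Real.arcsin (S.σ j / r)) - Real.pi / 4|
      ≤ 1 / weight (2 * k) * (δ * (Real.pi / 4)) := by gcongr; exact hS.trans hub
    _ = _ := by ring

end Transform

/-! ### The circuit -/

section Construction

/-- The basis vectors `|1⟩|i⟩|0⟩`. -/
def indexKet (r n : ℕ) (i : Fin r) : Vec (Fin 2 × (Fin r × Fin (2 ^ n))) :=
  tensor (ket 1) (ket (i, 0))

theorem orthonormal_indexKet (r n : ℕ) : Orthonormal ℂ (indexKet r n) := by
  rw [orthonormal_iff_ite]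
  intro i j
  simp only [indexKet, inner_tensor, inner_ket, if_true, one_mul, Prod.mk.injEq, and_true]

variable {r n : ℕ}

theorem queryIso_psi_apply {Uψ Uφ : Matrix.unitaryGroup (Fin r × Fin (2 ^ n)) ℂ}
    {Uin : Matrix.unitaryGroup (Fin (2 ^ n)) ℂ} (x : Vec (Fin 2 × (Fin r × Fin (2 ^ n)))) :
    queryIso .psi (Uψ, Uφ, Uin) x = act (controlled (Uψ : Matrix _ _ ℂ)) x := rfl

theorem queryIso_phi_apply {Uψ Uφ : Matrix.unitaryGroup (Fin r × Fin (2 ^ n)) ℂ}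
    {Uin : Matrix.unitaryGroup (Fin (2 ^ n)) ℂ} (x : Vec (Fin 2 × (Fin r × Fin (2 ^ n)))) :
    queryIso .phi (Uψ, Uφ, Uin) x = act (controlled (Uφ : Matrix _ _ ℂ)) x := rfl

/-- The block encoding of `A / r`. -/
def blockEncoding (o : Oracle r n) :
    Reg (Fin 2) (Vec (Fin 2 × (Fin r × Fin (2 ^ n)))) ≃ₗᵢ[ℂ]
      Reg (Fin 2) (Vec (Fin 2 × (Fin r × Fin (2 ^ n)))) :=
  encode (queryIso .psi o) (queryIso .phi o) (Submodule.span ℂ (Set.range (indexKet r n)))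

/-- One use of `cU_φ` and one of `cU_ψ†`; the reflection between them is fixed. The joint count 2
bounds the uses of each oracle. -/
theorem implementable_blockEncoding :
    Implementable ((fun F o => extend (Fin 2) (F o)) '' inputSet r n)
      ((fun F o => extend (Fin 2) (F o)) '' querySet r n) 2 blockEncoding := by
  refine Implementable.mul (N := 1) (M := 1) (Implementable.mul (N := 1) (M := 0)
    (.counted ⟨_, ⟨.phi, rfl⟩, rfl⟩)
    (.fixed (select ![1, (Submodule.span ℂ (Set.range (indexKet r n))).reflection])))
    (.counted ⟨_, ⟨.psiAdj, rfl⟩, ?_⟩)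
  funext o
  rw [queryIso_psiAdj]
  exact map_inv (extend (Fin 2)) (queryIso .psi o)

variable [NeZero r]

/-- The uniform superposition. -/
def plus (r : ℕ) : Vec (Fin r) := WithLp.toLp 2 fun _ => ((1 / √r : ℝ) : ℂ)

theorem norm_plus : ‖plus r‖ = 1 := by
  have hr : (0 : ℝ) < r := by exact_mod_cast NeZero.pos r
  rw [← sq_eq_sq₀ (norm_nonneg _) zero_le_one, PiLp.norm_sq_eq_of_L2]
  simp only [plus, Complex.norm_real, Real.norm_eq_abs, sq_abs, div_pow, one_pow,
    Real.sq_sqrt hr.le, Finset.sum_const, Finset.card_univ, Fintype.card_fin, nsmul_eq_mul]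
  field_simp

/-- The embedding `y ↦ |1⟩|+⟩|y⟩`. -/
def baseEmbedding (r n : ℕ) [NeZero r] :
    Vec (Fin (2 ^ n)) →ₗᵢ[ℂ] Vec (Fin 2 × (Fin r × Fin (2 ^ n))) :=
  (tensorLeft (ket 1) (norm_ket 1)).comp (tensorLeft (plus r) norm_plus)

theorem baseEmbedding_apply (y : Vec (Fin (2 ^ n))) :
    baseEmbedding r n y = tensor (ket 1) (tensor (plus r) y) := rfl

theorem inner_baseEmbedding {U : Matrix.unitaryGroup (Fin r × Fin (2 ^ n)) ℂ}
    {ψ : Fin r → Vec (Fin (2 ^ n))} (h : IsStatePreparation U ψ) (i : Fin r)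
    (y : Vec (Fin (2 ^ n))) :
    inner ℂ (baseEmbedding r n y) (act (controlled (U : Matrix _ _ ℂ)) (indexKet r n i)) =
      ((1 / √r : ℝ) : ℂ) * inner ℂ y (ψ i) := by
  have hplus : inner ℂ (plus r) (ket i) = ((1 / √r : ℝ) : ℂ) := by
    rw [ket, EuclideanSpace.inner_single_right]
    simp only [plus, Complex.conj_ofReal, one_mul]
  rw [indexKet, act_controlled, h i, baseEmbedding_apply, inner_tensor, inner_tensor, inner_ket, hplus]
  simp only [if_true, one_mul]

/-- The embedding of the state space into the workspace of the block encoding. -/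
def embedding (r n : ℕ) [NeZero r] :
    Vec (Fin (2 ^ n)) →ₗᵢ[ℂ] Reg (Fin 2) (Vec (Fin 2 × (Fin r × Fin (2 ^ n)))) :=
  (attach (fun _ : Fin 2 => (1 / √2 : ℝ)) sum_sq_inv_sqrt_two).comp (baseEmbedding r n)

/-- The subspace on which the block encoding acts as `A / r`. -/
def codeSpace (r n : ℕ) [NeZero r] :
    Submodule ℂ (Reg (Fin 2) (Vec (Fin 2 × (Fin r × Fin (2 ^ n))))) :=
  (LinearMap.range (baseEmbedding r n).toLinearMap).map
    (attach (fun _ : Fin 2 => (1 / √2 : ℝ)) sum_sq_inv_sqrt_two).toLinearMap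

theorem embedding_mem (y : Vec (Fin (2 ^ n))) : embedding r n y ∈ codeSpace r n :=
  Submodule.mem_map_of_mem (LinearMap.mem_range_self _ y)

variable {Uψ Uφ : Matrix.unitaryGroup (Fin r × Fin (2 ^ n)) ℂ}
  {Uin : Matrix.unitaryGroup (Fin (2 ^ n)) ℂ} {ψ φ : Fin r → Vec (Fin (2 ^ n))}

theorem starProjection_blockEncoding (hψ : IsStatePreparation Uψ ψ) (hφ : IsStatePreparation Uφ φ)
    (y : Vec (Fin (2 ^ n))) :
    (codeSpace r n).starProjection (blockEncoding (Uψ, Uφ, Uin) (embedding r n y)) =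
      embedding r n (((1 / r : ℝ) : ℂ) • ∑ i, inner ℂ (ψ i) y • φ i) := by
  refine starProjection_encode_eq (P := queryIso .psi (Uψ, Uφ, Uin))
    (Q := queryIso .phi (Uψ, Uφ, Uin)) (baseEmbedding r n) (orthonormal_indexKet r n)
    (fun i y => ?_) (fun i y => ?_) y
  · rw [queryIso_psi_apply, inner_baseEmbedding hψ]
  · rw [queryIso_phi_apply, inner_baseEmbedding hφ]

theorem starProjection_inv_blockEncoding (hψ : IsStatePreparation Uψ ψ)
    (hφ : IsStatePreparation Uφ φ) (y : Vec (Fin (2 ^ n))) :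
    (codeSpace r n).starProjection ((blockEncoding (Uψ, Uφ, Uin))⁻¹ (embedding r n y)) =
      embedding r n (((1 / r : ℝ) : ℂ) • ∑ i, inner ℂ (φ i) y • ψ i) := by
  rw [blockEncoding, inv_encode]
  refine starProjection_encode_eq (P := queryIso .phi (Uψ, Uφ, Uin))
    (Q := queryIso .psi (Uψ, Uφ, Uin)) (baseEmbedding r n) (orthonormal_indexKet r n)
    (fun i y => ?_) (fun i y => ?_) y
  · rw [queryIso_phi_apply, inner_baseEmbedding hφ]
  · rw [queryIso_psi_apply, inner_baseEmbedding hψ]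

theorem extend_inputIso_embedding (x : Vec (Fin (2 ^ n))) :
    extend (Fin 2) (inputIso (Uψ, Uφ, Uin)) (embedding r n x) =
      embedding r n (act (Uin : Matrix (Fin (2 ^ n)) (Fin (2 ^ n)) ℂ) x) := by
  have h : inputIso (Uψ, Uφ, Uin) (baseEmbedding r n x) =
      baseEmbedding r n (act (Uin : Matrix (Fin (2 ^ n)) (Fin (2 ^ n)) ℂ) x) := by
    rw [inputIso, toIsometry_apply, baseEmbedding_apply, act_kronecker, act_kronecker, act_one,
      act_one, baseEmbedding_apply]
  simp only [embedding, LinearIsometry.coe_comp, Function.comp_apply]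
  rw [extend_attach, h]

theorem norm_act_unitary {ι : Type} [Fintype ι] [DecidableEq ι] (U : Matrix.unitaryGroup ι ℂ)
    (x : Vec ι) : ‖act (U : Matrix ι ι ℂ) x‖ = ‖x‖ := by
  rw [← toIsometry_apply, LinearIsometryEquiv.norm_map]

/-- The singular values of the Procrustes matrix are at most `r`. -/
theorem SVD.σ_le (S : SVD (procrustesMatrix ψ φ)) (hψ : IsStatePreparation Uψ ψ)
    (hφ : IsStatePreparation Uφ φ) (j : Fin S.rank) : S.σ j ≤ r := by
  have hr : (0 : ℝ) < r := by exact_mod_cast NeZero.pos r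
  have h := (S.isSingularPair (embedding r n) embedding_mem
    (starProjection_blockEncoding (Uin := 1) hψ hφ)
    (starProjection_inv_blockEncoding (Uin := 1) hψ hφ) j).norm_le_one
      (by rw [LinearIsometry.norm_map, S.v_orthonormal.1])
      (by rw [LinearIsometry.norm_map, S.w_orthonormal.1])
  have := (le_abs_self _).trans h
  rwa [div_le_one hr] at this

/-- The map `|0̄⟩|y⟩` as an isometry. -/
def paddedIsometry (r n a : ℕ) [NeZero r] : Vec (Fin (2 ^ n)) →ₗᵢ[ℂ] Vec (Work r n a) :=
  (tensorRight (ket 0) (norm_ket 0)).comp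
    ((tensorLeft (ket 0) (norm_ket 0)).comp (tensorLeft (ket 0) (norm_ket 0)))

theorem paddedIsometry_apply (a : ℕ) (y : Vec (Fin (2 ^ n))) :
    paddedIsometry r n a y = padded a y := rfl

theorem norm_padded (a : ℕ) (y : Vec (Fin (2 ^ n))) : ‖padded (r := r) a y‖ = ‖y‖ := by
  rw [← paddedIsometry_apply, LinearIsometry.norm_map]

/-- A product of oracles is implemented by a circuit, for any choice of the initial vector and of
the encoding of the output. -/
theorem Implementable.exists_circuit_norm_sub {I J K : Type} [Fintype I] [Fintype J] [Fintype K]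
    {a : ℕ} (e : Fin (2 ^ a) ≃ K × J × I) {N : ℕ}
    {F : Oracle r n → (Reg K (Reg J (Reg I (Vec (Fin 2 × (Fin r × Fin (2 ^ n)))))) ≃ₗᵢ[ℂ]
      Reg K (Reg J (Reg I (Vec (Fin 2 × (Fin r × Fin (2 ^ n)))))))}
    (h : Implementable
      ((fun F o => extend K (F o)) '' ((fun F o => extend J (F o)) ''
        ((fun F o => extend I (F o)) '' inputSet r n)))
      ((fun F o => extend K (F o)) '' ((fun F o => extend J (F o)) ''
        ((fun F o => extend I (F o)) '' querySet r n))) N F)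
    {e₀ : Reg K (Reg J (Reg I (Vec (Fin 2 × (Fin r × Fin (2 ^ n))))))} (he₀ : ‖e₀‖ = 1)
    (f : Vec (Fin (2 ^ n)) →ₗᵢ[ℂ] Reg K (Reg J (Reg I (Vec (Fin 2 × (Fin r × Fin (2 ^ n))))))) :
    ∃ circ : Circuit r n a, (∀ q, Circuit.uses q circ ≤ N) ∧
      ∀ Uψ Uφ Uin y, ‖circ.output Uψ Uφ Uin - padded a y‖ = ‖F (Uψ, Uφ, Uin) e₀ - f y‖ := by
  -- Fixed unitaries before and after the product turn the all-zero state into e₀ and the encoding f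
  -- of the output into the padded one.
  obtain ⟨V, hV⟩ := exists_unitary_apply_eq (x := padded (r := r) a (ket (0 : Fin (2 ^ n))))
    (y := flatten e e₀) (by rw [norm_padded, norm_ket]) (by rw [LinearIsometryEquiv.norm_map, he₀])
  obtain ⟨V', hV'⟩ := exists_unitary_comp_eq ((flatten e).toLinearIsometry.comp f)
    (paddedIsometry r n a)
  obtain ⟨circ, hcount, hrun⟩ := h.exists_circuit_flatten e V V'
  refine ⟨circ, hcount, fun Uψ Uφ Uin y => ?_⟩
  have hrun' := hrun (Uψ, Uφ, Uin) (padded a (ket 0))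
  rw [hV, LinearIsometryEquiv.symm_apply_apply] at hrun'
  have hpad : V' (flatten e (f y)) = padded a y := hV' y
  rw [Circuit.output, hrun', ← hpad, ← map_sub, LinearIsometryEquiv.norm_map, ← map_sub,
    LinearIsometryEquiv.norm_map]

/-- The preparation of `P(A / r) |x⟩`, where `P` is a multiple of an approximation of the sign
function. -/
def transformed (t : ℕ) (o : Oracle r n) :
    Reg (Fin 2 × Fin (2 * 2 ^ t)) (Reg (Fin 2) (Vec (Fin 2 × (Fin r × Fin (2 ^ n))))) ≃ₗᵢ[ℂ]
      Reg (Fin 2 × Fin (2 * 2 ^ t)) (Reg (Fin 2) (Vec (Fin 2 × (Fin r × Fin (2 ^ n))))) :=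
  selectGrover (blockEncoding o) (codeSpace r n) (codeSpace r n) (2 * 2 ^ t) (fun j => (j.2 : ℕ)) *
    extend _ (extend (Fin 2) (inputIso o))

theorem implementable_transformed (t : ℕ) :
    Implementable
      ((fun F o => extend (Fin 2 × Fin (2 * 2 ^ t)) (F o)) ''
        ((fun F o => extend (Fin 2) (F o)) '' inputSet r n))
      ((fun F o => extend (Fin 2 × Fin (2 * 2 ^ t)) (F o)) ''
        ((fun F o => extend (Fin 2) (F o)) '' querySet r n))
      ((2 * (2 * 2 ^ t) + 1) * 2) (transformed t) :=
  (implementable_blockEncoding.selectGrover (image_inv_mem _ inv_mem_inputSet)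
    (image_inv_mem _ inv_mem_querySet) _ _ _ _).mul
    (.free ⟨_, ⟨_, Or.inl rfl, rfl⟩, rfl⟩)

variable (t₁ t₂ m : ℕ) {ρ : ℝ}

/-- The initial vector of the first amplification. -/
def initial (t : ℕ) (hp : ∑ j, amplitude (2 * 2 ^ t) 1 j ^ 2 = 1) :
    Reg (Fin 2 × Fin (2 * 2 ^ t)) (Reg (Fin 2) (Vec (Fin 2 × (Fin r × Fin (2 ^ n))))) :=
  attach (amplitude (2 * 2 ^ t) 1) hp (embedding r n (ket 0))

/-- The target subspace of the first amplification. -/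
def target (t : ℕ) (hp : ∑ j, amplitude (2 * 2 ^ t) 1 j ^ 2 = 1) :
    Submodule ℂ
      (Reg (Fin 2 × Fin (2 * 2 ^ t)) (Reg (Fin 2) (Vec (Fin 2 × (Fin r × Fin (2 ^ n)))))) :=
  (codeSpace r n).map (attach (amplitude (2 * 2 ^ t) 1) hp).toLinearMap

theorem norm_initial (t : ℕ) (hp : ∑ j, amplitude (2 * 2 ^ t) 1 j ^ 2 = 1) :
    ‖initial (r := r) (n := n) t hp‖ = 1 := by
  rw [initial, LinearIsometry.norm_map, LinearIsometry.norm_map, norm_ket]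

/-- The first amplification, with a register that holds the number of steps. -/
def amplified (o : Oracle r n) (hp : ∑ j, amplitude (2 * 2 ^ t₁) 1 j ^ 2 = 1) :
    Reg (Fin 2 × Fin (2 * 2 ^ t₂)) (Reg (Fin 2 × Fin (2 * 2 ^ t₁))
      (Reg (Fin 2) (Vec (Fin 2 × (Fin r × Fin (2 ^ n)))))) ≃ₗᵢ[ℂ]
    Reg (Fin 2 × Fin (2 * 2 ^ t₂)) (Reg (Fin 2 × Fin (2 * 2 ^ t₁))
      (Reg (Fin 2) (Vec (Fin 2 × (Fin r × Fin (2 ^ n)))))) :=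
  selectGrover (transformed t₁ o) (Submodule.span ℂ {initial t₁ hp}) (target t₁ hp) (2 * 2 ^ t₂)
    (fun j => (j.2 : ℕ))

theorem implementable_amplified (hp : ∑ j, amplitude (2 * 2 ^ t₁) 1 j ^ 2 = 1) :
    Implementable
      ((fun F o => extend (Fin 2 × Fin (2 * 2 ^ t₂)) (F o)) ''
        ((fun F o => extend (Fin 2 × Fin (2 * 2 ^ t₁)) (F o)) ''
        ((fun F o => extend (Fin 2) (F o)) '' inputSet r n)))
      ((fun F o => extend (Fin 2 × Fin (2 * 2 ^ t₂)) (F o)) ''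
        ((fun F o => extend (Fin 2 × Fin (2 * 2 ^ t₁)) (F o)) ''
        ((fun F o => extend (Fin 2) (F o)) '' querySet r n)))
      ((2 * (2 * 2 ^ t₂) + 1) * ((2 * (2 * 2 ^ t₁) + 1) * 2)) (fun o => amplified t₁ t₂ o hp) :=
  (implementable_transformed t₁).selectGrover (image_inv_mem _ (image_inv_mem _ inv_mem_inputSet))
    (image_inv_mem _ (image_inv_mem _ inv_mem_querySet)) _ _ _ _

/-- The projected vector Y is close to T · overlap times the ideal state, with T = π/(4Λ₁). Its norm
is the amplitude s to be amplified, and its direction y is what the second stage will output. -/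
theorem starProjection_transformed (t : ℕ) {κ c ε : ℝ} (hκ : 0 < κ) (hc : 0 < c) (hε : 0 < ε)
    (hε2 : ε ≤ 2) (h₁ : 11 * (r * κ) / ε ≤ (2 * 2 ^ t : ℕ))
    (hp : ∑ j, amplitude (2 * 2 ^ t) 1 j ^ 2 = 1) {x : Vec (Fin (2 ^ n))}
    (S : SVD (procrustesMatrix ψ φ)) (hψ : IsStatePreparation Uψ ψ) (hφ : IsStatePreparation Uφ φ)
    (hx : act (Uin : Matrix (Fin (2 ^ n)) (Fin (2 ^ n)) ℂ) (ket 0) = x)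
    (hrow : S.row = Submodule.span ℂ (Set.range ψ)) (hσ : 1 / S.sigmaMin ≤ κ)
    (hov : c < overlap ψ x) :
    ∃ (s : ℝ) (y : Vec (Fin (2 ^ n))), Real.pi / 4 / weight (2 * 2 ^ t) * c / 2 ≤ s ∧ ‖y‖ = 1 ∧
      (target t hp).starProjection (transformed t (Uψ, Uφ, Uin) (initial t hp)) =
        (s : ℂ) • attach (amplitude (2 * 2 ^ t) 1) hp (embedding r n y) ∧
      ‖y - idealState S x‖ ≤ ε / 2 := by
  have hpi := Real.pi_gt_d2
  have hk : 0 < 2 ^ t := by positivity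
  have hM : 0 < 2 * 2 ^ t := by positivity
  have hov0 : 0 < overlap ψ x := hc.trans hov
  have hw := one_le_weight hM
  have hM' : (0 : ℝ) < (2 * 2 ^ t : ℕ) := by exact_mod_cast hM
  have hr : (0 : ℝ) < r := by exact_mod_cast NeZero.pos r
  obtain ⟨Y, hY, hYle⟩ := S.exists_starProjection_eq hrow (embedding r n) embedding_mem
    (starProjection_blockEncoding (Uin := Uin) hψ hφ)
    (starProjection_inv_blockEncoding (Uin := Uin) hψ hφ) (δ := ε / 4) hκ hσ hk (by
      -- Normalization doubles the error, so δ = ε/4; the requirement is then M₁ ≥ (32/π) rκ/ε, and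
      -- 32/π < 11.
      rw [div_le_iff₀ hε] at h₁
      rw [div_le_iff₀ (by positivity)]
      nlinarith [mul_pos hM' hε, mul_pos hr hκ]) hp hov0
  set T := Real.pi / 4 / weight (2 * 2 ^ t) with hT
  have hT0 : 0 < T := by positivity
  have hid := S.norm_idealState hrow hov0
  -- Here δ = ε/4 ≤ 1/2, so at least half of T · overlap survives.
  have hYlow : T * c / 2 ≤ ‖Y‖ := by
    have h1 : ‖((T * overlap ψ x : ℝ) : ℂ) • idealState S x‖ = T * overlap ψ x := by
      rw [norm_smul, hid, Complex.norm_real, Real.norm_eq_abs, abs_of_pos (by positivity), mul_one]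
    have h2 := norm_sub_norm_le (((T * overlap ψ x : ℝ) : ℂ) • idealState S x) Y
    rw [norm_sub_rev, h1] at h2
    have h3 : T * c ≤ T * overlap ψ x := by gcongr
    nlinarith [mul_pos hT0 hov0]
  have hTc : 0 < T * c / 2 := by positivity
  have hYpos : 0 < ‖Y‖ := hTc.trans_le hYlow
  refine ⟨‖Y‖, ((1 / ‖Y‖ : ℝ) : ℂ) • Y, hYlow, ?_, ?_, ?_⟩
  · rw [norm_smul, Complex.norm_real, Real.norm_eq_abs, abs_of_pos (by positivity), one_div,
      inv_mul_cancel₀ hYpos.ne']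
  · rw [initial, transformed, mul_apply, extend_attach, extend_inputIso_embedding, hx, ← map_smul,
      ← map_smul, smul_smul, ← Complex.ofReal_mul, mul_one_div_cancel hYpos.ne', Complex.ofReal_one,
      one_smul]
    exact hY
  · exact (norm_normalize_sub_le hid (norm_pos_iff.1 hYpos) (by positivity) hYle).trans_eq (by ring)

theorem norm_amplified_sub_le {κ c ε : ℝ} (hκ : 0 < κ) (hc : 0 < c) (hε : 0 < ε) (hε2 : ε ≤ 2)
    (h₁ : 11 * (r * κ) / ε ≤ (2 * 2 ^ t₁ : ℕ))
    (h₂ : 41 * weight (2 * 2 ^ t₁) / (c * ε) ≤ (2 * 2 ^ t₂ : ℕ)) (hm : 1 ≤ m)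
    (hρ : ρ / weight (2 * 2 ^ t₂) * (Real.pi / 4) = Real.sin (Real.pi / (2 * (2 * m + 1))))
    (hp₁ : ∑ j, amplitude (2 * 2 ^ t₁) 1 j ^ 2 = 1) (hp₂ : ∑ j, amplitude (2 * 2 ^ t₂) 1 j ^ 2 = 1)
    (hq₂ : ∑ j, amplitude (2 * 2 ^ t₂) ρ j ^ 2 = 1) {x : Vec (Fin (2 ^ n))}
    (S : SVD (procrustesMatrix ψ φ)) (hψ : IsStatePreparation Uψ ψ) (hφ : IsStatePreparation Uφ φ)
    (hx : act (Uin : Matrix (Fin (2 ^ n)) (Fin (2 ^ n)) ℂ) (ket 0) = x)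
    (hrow : S.row = Submodule.span ℂ (Set.range ψ)) (hσ : 1 / S.sigmaMin ≤ κ)
    (hov : c < overlap ψ x) :
    ‖(amplified t₁ t₂ (Uψ, Uφ, Uin) hp₁ * grover (amplified t₁ t₂ (Uψ, Uφ, Uin) hp₁)
        (Submodule.span ℂ {attach (amplitude (2 * 2 ^ t₂) 1) hp₂ (initial t₁ hp₁)})
        ((target t₁ hp₁).map (attach (amplitude (2 * 2 ^ t₂) ρ) hq₂).toLinearMap) ^ m)
        (attach (amplitude (2 * 2 ^ t₂) 1) hp₂ (initial t₁ hp₁)) -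
      attach (amplitude (2 * 2 ^ t₂) ρ) hq₂ (attach (amplitude (2 * 2 ^ t₁) 1) hp₁
        (embedding r n (idealState S x)))‖ ≤ ε := by
  have hpi := Real.pi_gt_d2
  have hk₂ : 0 < 2 ^ t₂ := by positivity
  have hw₁ := one_le_weight (M := 2 * 2 ^ t₁) (by positivity)
  have hM₂ : (0 : ℝ) < (2 * 2 ^ t₂ : ℕ) := by exact_mod_cast (by positivity : 0 < 2 * 2 ^ t₂)
  obtain ⟨s, y, hs, hy, hproj, hdist⟩ := starProjection_transformed t₁ hκ hc hε hε2 h₁ hp₁ S hψ hφ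
    hx hrow hσ hov
  have hmem : attach (amplitude (2 * 2 ^ t₁) 1) hp₁ (embedding r n y) ∈ target t₁ hp₁ :=
    Submodule.mem_map_of_mem (embedding_mem y)
  have hnorm : ‖attach (amplitude (2 * 2 ^ t₁) 1) hp₁ (embedding r n y)‖ = 1 := by
    rw [LinearIsometry.norm_map, LinearIsometry.norm_map, hy]
  have hW : amplified t₁ t₂ (Uψ, Uφ, Uin) hp₁ = selectGrover (transformed t₁ (Uψ, Uφ, Uin))
      (Submodule.span ℂ {initial t₁ hp₁}) (target t₁ hp₁) (2 * 2 ^ t₂) (fun j => (j.2 : ℕ)) := rfl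
  have hdist' : ‖attach (amplitude (2 * 2 ^ t₁) 1) hp₁ (embedding r n y) -
      attach (amplitude (2 * 2 ^ t₁) 1) hp₁ (embedding r n (idealState S x))‖ ≤ ε / 2 := by
    rwa [← map_sub, LinearIsometry.norm_map, ← map_sub, LinearIsometry.norm_map]
  refine norm_grover_selectGrover_sub_le_of_le (norm_initial t₁ hp₁) hmem hnorm hproj
    (by positivity) hs hk₂ hm ?_ hε2 hdist' hρ hp₂ hq₂ hW
  -- With s₀ = πc/(8Λ₁) the requirement is M₂ ≥ (128/π) Λ₁/(cε), and 128/π < 41.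
  rw [div_le_iff₀ (by positivity)] at h₂
  rw [div_le_div_iff₀ (by positivity) (by positivity)]
  have e3 : ε * (Real.pi * (2 * 2 ^ t₂ : ℕ) *
      (Real.pi / 4 / weight (2 * 2 ^ t₁) * c / 2)) =
      Real.pi ^ 2 / 8 * ((2 * 2 ^ t₂ : ℕ) * (c * ε)) / weight (2 * 2 ^ t₁) := by
    field_simp; norm_num
  rw [e3, le_div_iff₀ (by positivity)]
  have e4 : Real.pi ^ 2 / 8 * (41 * weight (2 * 2 ^ t₁)) ≤
      Real.pi ^ 2 / 8 * ((2 * 2 ^ t₂ : ℕ) * (c * ε)) := by gcongr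
  refine le_trans ?_ e4
  nlinarith [mul_pos Real.pi_pos (zero_lt_one.trans_le hw₁)]

theorem exists_circuit {κ c ε : ℝ} (hκ : 0 < κ) (hc : 0 < c) (hε : 0 < ε) (hε2 : ε ≤ 2)
    (h₁ : 11 * (r * κ) / ε ≤ (2 * 2 ^ t₁ : ℕ))
    (h₂ : 41 * weight (2 * 2 ^ t₁) / (c * ε) ≤ (2 * 2 ^ t₂ : ℕ)) (hm : 1 ≤ m)
    (hρ0 : 0 ≤ ρ) (hρ1 : ρ ≤ 1)
    (hρ : ρ / weight (2 * 2 ^ t₂) * (Real.pi / 4) = Real.sin (Real.pi / (2 * (2 * m + 1)))) :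
    ∃ (a : ℕ) (circ : Circuit r n a),
      (∀ q, Circuit.uses q circ ≤
        (2 * m + 1) * ((2 * (2 * 2 ^ t₂) + 1) * ((2 * (2 * 2 ^ t₁) + 1) * 2))) ∧
      ∀ (ψ φ : Fin r → Vec (Fin (2 ^ n))) (Uψ Uφ : Matrix.unitaryGroup (Fin r × Fin (2 ^ n)) ℂ)
        (Uin : Matrix.unitaryGroup (Fin (2 ^ n)) ℂ) (x : Vec (Fin (2 ^ n)))
        (S : SVD (procrustesMatrix ψ φ)),
        IsStatePreparation Uψ ψ → IsStatePreparation Uφ φ →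
        act (Uin : Matrix (Fin (2 ^ n)) (Fin (2 ^ n)) ℂ) (ket 0) = x →
        S.row = Submodule.span ℂ (Set.range ψ) → 1 / S.sigmaMin ≤ κ → c < overlap ψ x →
        ‖circ.output Uψ Uφ Uin - padded a (idealState S x)‖ ≤ ε := by
  have hp₁ := sum_sq_amplitude (M := 2 * 2 ^ t₁) (by positivity) zero_le_one le_rfl
  have hp₂ := sum_sq_amplitude (M := 2 * 2 ^ t₂) (by positivity) zero_le_one le_rfl
  have hq₂ := sum_sq_amplitude (M := 2 * 2 ^ t₂) (by positivity) hρ0 hρ1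
  -- The two step registers have dimensions 2^(t₂+2) and 2^(t₁+2), and the block encoding adds one
  -- qubit. This is why the lengths are powers of two.
  obtain ⟨e⟩ : Nonempty (Fin (2 ^ (t₂ + t₁ + 5)) ≃
      (Fin 2 × Fin (2 * 2 ^ t₂)) × (Fin 2 × Fin (2 * 2 ^ t₁)) × Fin 2) :=
    ⟨Fintype.equivOfCardEq (by
      simp only [Fintype.card_fin, Fintype.card_prod]
      ring)⟩
  obtain ⟨circ, hcount, hout⟩ := ((implementable_amplified (r := r) (n := n) t₁ t₂ hp₁).grover_pow
    (image_inv_mem _ (image_inv_mem _ (image_inv_mem _ inv_mem_inputSet)))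
    (image_inv_mem _ (image_inv_mem _ (image_inv_mem _ inv_mem_querySet)))
    (Submodule.span ℂ {attach (amplitude (2 * 2 ^ t₂) 1) hp₂ (initial t₁ hp₁)})
    ((target t₁ hp₁).map (attach (amplitude (2 * 2 ^ t₂) ρ) hq₂).toLinearMap)
    m).exists_circuit_norm_sub e (e₀ := attach (amplitude (2 * 2 ^ t₂) 1) hp₂ (initial t₁ hp₁))
    (by rw [LinearIsometry.norm_map, norm_initial])
    ((attach (amplitude (2 * 2 ^ t₂) ρ) hq₂).comp
      ((attach (amplitude (2 * 2 ^ t₁) 1) hp₁).comp (embedding r n)))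
  refine ⟨_, circ, hcount, fun ψ φ Uψ Uφ Uin x S hψ hφ hx hrow hσ hov => ?_⟩
  refine (hout Uψ Uφ Uin (idealState S x)).trans_le ?_
  exact norm_amplified_sub_le t₁ t₂ m hκ hc hε hε2 h₁ h₂ hm hρ hp₁ hp₂ hq₂ S hψ hφ hx hrow hσ hov

end Construction

end

/-! ### Choice of the parameters -/

theorem exists_two_mul_two_pow {X : ℝ} (hX : 2 ≤ X) :
    ∃ t : ℕ, X ≤ (2 * 2 ^ t : ℕ) ∧ ((2 * 2 ^ t : ℕ) : ℝ) ≤ 2 * X := by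
  obtain ⟨t, h1, h2⟩ := exists_nat_pow_near (x := X / 2) (y := 2) (by linarith) one_lt_two
  refine ⟨t + 1, ?_, ?_⟩
  · push_cast
    linarith
  · push_cast
    rw [pow_succ]
    linarith

/-- Lets additive constants be absorbed into the logarithm. -/
theorem one_le_two_mul_log {z : ℝ} (hz : 0 ≤ z) : 1 ≤ 2 * Real.log (2 + z) := by
  have h := Real.log_le_log zero_lt_two (by linarith : (2 : ℝ) ≤ 2 + z)
  have := Real.log_two_gt_d9
  linarith

theorem weight_le_mul_log {M j : ℕ} (hM : 0 < M) {z : ℝ} (hz : 0 ≤ z)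
    (h : (M : ℝ) ≤ (2 + z) ^ j) : weight M ≤ (j + 2) * Real.log (2 + z) := by
  have h1 := Real.log_le_log (by exact_mod_cast hM) h
  rw [Real.log_pow] at h1
  have := weight_le M
  have := one_le_two_mul_log hz
  linarith

theorem weight_le_self {M : ℕ} (hM : 0 < M) : weight M ≤ M := by
  have h := Real.log_le_sub_one_of_pos (x := M) (by exact_mod_cast hM)
  linarith [weight_le M]

/-- The true cost is of order R/(cε²) times log²: the factor m contributes one logarithm and Λ₁ in
M₂ the other. -/
theorem cost_le {R c ε : ℝ} (hR : 1 ≤ R) (hc : 0 < c) (hc1 : c ≤ 1) (hε : 0 < ε) (hε2 : ε ≤ 2)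
    {M₁ M₂ m : ℕ} (hM₁ : 0 < M₁) (hM₂ : 0 < M₂) (h₁ : (M₁ : ℝ) ≤ 2 * (11 * R / ε))
    (h₂ : (M₂ : ℝ) ≤ 2 * (41 * weight M₁ / (c * ε))) (hm : (m : ℝ) ≤ weight M₂ + 1) :
    (((2 * m + 1) * ((2 * M₂ + 1) * ((2 * M₁ + 1) * 2)) : ℕ) : ℝ) ≤
      40000000 * (R ^ 2 / (c ^ (3 / 2 : ℝ) * ε ^ 3)) * Real.log (2 + R / (c * ε)) ^ 2 := by
  have hM₁' : (1 : ℝ) ≤ M₁ := by exact_mod_cast hM₁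
  have hM₂' : (1 : ℝ) ≤ M₂ := by exact_mod_cast hM₂
  have hw₁ := one_le_weight hM₁
  have hw₂ := one_le_weight hM₂
  set z := R / (c * ε) with hz
  have hz0 : 0 < z := by positivity
  set l := Real.log (2 + z) with hl
  have hRz : R / ε ≤ z := by
    rw [hz]
    apply div_le_div_of_nonneg_left (by linarith) (by positivity)
    nlinarith
  have hcz : 1 / (c * ε) ≤ z := by rw [hz]; gcongr
  have hM₁z : (M₁ : ℝ) ≤ 22 * z := by
    calc (M₁ : ℝ) ≤ 22 * (R / ε) := h₁.trans_eq (by ring)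
      _ ≤ _ := by gcongr
  have hpow : ∀ i : ℕ, (2 : ℝ) ^ i ≤ (2 + z) ^ i := fun i =>
    pow_le_pow_left₀ zero_le_two (by linarith) i
  have hΛ₁ : weight M₁ ≤ 8 * l := by
    -- The exponent 6 comes from 22 ≤ 2^5, and the exponent 13 for M₂ below from 1804 ≤ 2^11.
    refine (weight_le_mul_log hM₁ hz0.le (j := 6) ?_).trans (by push_cast; linarith)
    calc (M₁ : ℝ) ≤ 2 ^ 5 * (2 + z) := by linarith
      _ ≤ (2 + z) ^ 5 * (2 + z) := by gcongr; linarith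
      _ = _ := by ring
  have hM₂z : (M₂ : ℝ) ≤ 1804 * z ^ 2 := by
    calc (M₂ : ℝ) ≤ 82 * weight M₁ * (1 / (c * ε)) := h₂.trans_eq (by ring)
      _ ≤ 82 * (22 * z) * z := by
        gcongr
        exact (weight_le_self hM₁).trans hM₁z
      _ = _ := by ring
  have hΛ₂ : weight M₂ ≤ 15 * l := by
    refine (weight_le_mul_log hM₂ hz0.le (j := 13) ?_).trans (by push_cast; linarith)
    calc (M₂ : ℝ) ≤ 2 ^ 11 * (2 + z) ^ 2 := by nlinarith
      _ ≤ (2 + z) ^ 11 * (2 + z) ^ 2 := by gcongr; linarith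
      _ = _ := by ring
  have hl0 : 0 < l := by linarith
  -- The two sides differ by the factor 2R/(√c ε), which is at least one in this range.
  have hfin : R / (c * ε ^ 2) ≤ 2 * (R ^ 2 / (c ^ (3 / 2 : ℝ) * ε ^ 3)) := by
    have hcs : c ^ (3 / 2 : ℝ) = c * √c := by
      rw [Real.sqrt_eq_rpow, ← Real.rpow_one_add' hc.le (by norm_num)]
      norm_num
    have hs1 : √c ≤ 1 := Real.sqrt_le_iff.2 ⟨zero_le_one, by linarith⟩
    have hs0 : 0 < √c := Real.sqrt_pos.2 hc
    rw [hcs]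
    have e : 2 * (R ^ 2 / (c * √c * ε ^ 3)) = R / (c * ε ^ 2) * (2 * R / (√c * ε)) := by
      field_simp
    rw [e]
    apply le_mul_of_one_le_right (by positivity)
    rw [one_le_div (by positivity)]
    nlinarith
  have e1 : 2 * (m : ℝ) + 1 ≤ 5 * weight M₂ := by linarith
  have e2 : 2 * (M₂ : ℝ) + 1 ≤ 3 * M₂ := by linarith
  have e3 : 2 * (M₁ : ℝ) + 1 ≤ 3 * M₁ := by linarith
  push_cast
  calc (2 * (m : ℝ) + 1) * ((2 * M₂ + 1) * ((2 * M₁ + 1) * 2))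
      ≤ (5 * weight M₂) * ((3 * M₂) * ((3 * M₁) * 2)) := by gcongr
    _ ≤ (5 * (15 * l)) * ((3 * (2 * (41 * (8 * l) / (c * ε)))) * ((3 * (2 * (11 * R / ε))) * 2)) := by
        gcongr
        exact h₂.trans (by gcongr)
    _ = 19483200 * (R / (c * ε ^ 2)) * l ^ 2 := by field_simp; ring
    _ ≤ 19483200 * (2 * (R ^ 2 / (c ^ (3 / 2 : ℝ) * ε ^ 3))) * l ^ 2 := by gcongr
    _ ≤ _ := by
      have : 0 ≤ R ^ 2 / (c ^ (3 / 2 : ℝ) * ε ^ 3) * l ^ 2 := by positivity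
      nlinarith

theorem overlap_le_norm {r N : ℕ} (ψ : Fin r → Vec (Fin N)) (x : Vec (Fin N)) : overlap ψ x ≤ ‖x‖ :=
  Submodule.norm_starProjection_apply_le _ x

/-- Outside of the range of meaningful parameters, no queries are needed. -/
theorem exists_circuit_of_trivial (n : ℕ) {r : ℕ} [NeZero r] {κ c ε : ℝ} (hκ : 0 < κ) (hc : 0 < c)
    (hε : 0 < ε) (hpar : ¬(1 ≤ r * κ ∧ c ≤ 1 ∧ ε ≤ 2)) :
    ∃ (a : ℕ) (circ : Circuit r n a),
      (∀ q, (Circuit.uses q circ : ℝ) ≤ 40000000 * ((r : ℝ) ^ 2 * κ ^ 2 / (c ^ (3 / 2 : ℝ) * ε ^ 3)) *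
        Real.log (2 + r * κ / (c * ε)) ^ 2) ∧
      ∀ (ψ φ : Fin r → Vec (Fin (2 ^ n))) (Uψ Uφ : Matrix.unitaryGroup (Fin r × Fin (2 ^ n)) ℂ)
        (Uin : Matrix.unitaryGroup (Fin (2 ^ n)) ℂ) (x : Vec (Fin (2 ^ n)))
        (S : SVD (procrustesMatrix ψ φ)),
        IsStatePreparation Uψ ψ → IsStatePreparation Uφ φ →
        act (Uin : Matrix (Fin (2 ^ n)) (Fin (2 ^ n)) ℂ) (ket 0) = x →
        S.row = Submodule.span ℂ (Set.range ψ) → 1 / S.sigmaMin ≤ κ → c < overlap ψ x →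
        ‖circ.output Uψ Uφ Uin - padded a (idealState S x)‖ ≤ ε := by
  refine ⟨0, [], fun q => ?_, fun ψ φ Uψ Uφ Uin x S hψ hφ hx hrow hσ hov => ?_⟩
  · simp only [Circuit.uses, List.countP_nil, Nat.cast_zero]
    positivity
  have hov0 : 0 < overlap ψ x := hc.trans hov
  have hr : (0 : ℝ) < r := by exact_mod_cast NeZero.pos r
  have hc1 : c ≤ 1 := by
    refine hov.le.trans ((overlap_le_norm ψ x).trans_eq ?_)
    rw [← hx, norm_act_unitary, norm_ket]
  -- A positive overlap forces positive rank, and then 1/κ ≤ σ j ≤ r.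
  have hR : 1 ≤ r * κ := by
    have hrank : Nonempty (Fin S.rank) := by
      by_contra hempty
      rw [not_nonempty_iff] at hempty
      have := S.overlap_eq hrow x
      rw [Fintype.sum_empty] at this
      exact (pow_pos hov0 2).ne' this
    obtain ⟨j⟩ := hrank
    have h := (S.inv_le_σ hκ hσ j).trans (S.σ_le hψ hφ j)
    rwa [div_le_iff₀ hκ] at h
  -- Only this way of leaving the parameter range is compatible with the hypotheses, and two unit
  -- vectors are at distance at most 2.
  have hε2 : 2 < ε := by
    by_contra h
    exact hpar ⟨hR, hc1, not_lt.1 h⟩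
  have h1 : ‖Circuit.output (a := 0) [] Uψ Uφ Uin‖ = 1 :=
    (norm_padded 0 (ket (0 : Fin (2 ^ n)))).trans (norm_ket 0)
  have h2 : ‖padded (r := r) 0 (idealState S x)‖ = 1 := by
    rw [norm_padded, S.norm_idealState hrow hov0]
  refine (norm_sub_le _ _).trans ?_
  rw [h1, h2]
  linarith

theorem exists_circuit_uses_le (n : ℕ) {r : ℕ} [NeZero r] {κ c ε : ℝ} (hκ : 0 < κ) (hc : 0 < c)
    (hε : 0 < ε) (hR : 1 ≤ r * κ) (hc1 : c ≤ 1) (hε2 : ε ≤ 2) :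
    ∃ (a : ℕ) (circ : Circuit r n a),
      (∀ q, (Circuit.uses q circ : ℝ) ≤ 40000000 * ((r : ℝ) ^ 2 * κ ^ 2 / (c ^ (3 / 2 : ℝ) * ε ^ 3)) *
        Real.log (2 + r * κ / (c * ε)) ^ 2) ∧
      ∀ (ψ φ : Fin r → Vec (Fin (2 ^ n))) (Uψ Uφ : Matrix.unitaryGroup (Fin r × Fin (2 ^ n)) ℂ)
        (Uin : Matrix.unitaryGroup (Fin (2 ^ n)) ℂ) (x : Vec (Fin (2 ^ n)))
        (S : SVD (procrustesMatrix ψ φ)),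
        IsStatePreparation Uψ ψ → IsStatePreparation Uφ φ →
        act (Uin : Matrix (Fin (2 ^ n)) (Fin (2 ^ n)) ℂ) (ket 0) = x →
        S.row = Submodule.span ℂ (Set.range ψ) → 1 / S.sigmaMin ≤ κ → c < overlap ψ x →
        ‖circ.output Uψ Uφ Uin - padded a (idealState S x)‖ ≤ ε := by
  have hpi := Real.pi_pos
  obtain ⟨t₁, ht₁, ht₁'⟩ := exists_two_mul_two_pow (X := 11 * (r * κ) / ε) (by
    rw [le_div_iff₀ hε]; linarith)
  have hM₁ : 0 < 2 * 2 ^ t₁ := by positivity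
  have hw₁ := one_le_weight hM₁
  obtain ⟨t₂, ht₂, ht₂'⟩ := exists_two_mul_two_pow (X := 41 * weight (2 * 2 ^ t₁) / (c * ε)) (by
    rw [le_div_iff₀ (by positivity)]
    nlinarith)
  have hM₂ : 0 < 2 * 2 ^ t₂ := by positivity
  have hw₂ := one_le_weight hM₂
  set Λ := weight (2 * 2 ^ t₂) with hΛ
  have hceil := Nat.le_ceil Λ
  have hceil' := (Nat.ceil_lt_add_one (by linarith : 0 ≤ Λ)).le
  -- The target amplitude sin(π/(2(2m+1))) must be reachable from π/(4Λ) with a factor ρ ≤ 1; m ≥ Λ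
  -- gives 2(2m+1) ≥ 4Λ, which suffices.
  set m := ⌈Λ⌉₊ with hm
  have hm1 : 1 ≤ m := by
    have : (1 : ℝ) ≤ m := hw₂.trans hceil
    exact_mod_cast this
  have hangle : Real.pi / (2 * (2 * m + 1)) ≤ Real.pi / (4 * Λ) := by
    apply div_le_div_of_nonneg_left hpi.le (by positivity) (by linarith)
  have hangle0 : 0 < Real.pi / (2 * (2 * (m : ℝ) + 1)) := by positivity
  have hanglepi : Real.pi / (2 * (2 * (m : ℝ) + 1)) ≤ Real.pi := by
    apply div_le_self hpi.le
    linarith [(Nat.cast_nonneg m : (0 : ℝ) ≤ m)]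
  obtain ⟨a, circ, hcount, hcorrect⟩ := exists_circuit (r := r) (n := n) t₁ t₂ m
    (ρ := Real.sin (Real.pi / (2 * (2 * m + 1))) * (4 * Λ / Real.pi)) hκ hc hε hε2 ht₁ ht₂ hm1
    (mul_nonneg (Real.sin_nonneg_of_nonneg_of_le_pi hangle0.le hanglepi) (by positivity))
    (by
      calc _ ≤ Real.pi / (4 * Λ) * (4 * Λ / Real.pi) := by
            gcongr
            exact (Real.sin_le hangle0.le).trans hangle
        _ = 1 := by field_simp)
    (by
      rw [← hΛ]
      field_simp)
  refine ⟨a, circ, fun q => ?_, hcorrect⟩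
  have hle : (Circuit.uses q circ : ℝ) ≤ _ := Nat.cast_le.2 (hcount q)
  rw [← mul_pow]
  exact hle.trans (cost_le hR hc hc1 hε hε2 hM₁ hM₂ ht₁' ht₂' hceil')

end Procrustes

theorem theorem6 :
    ∃ (C : ℝ) (k : ℕ), 0 < C ∧
      ∀ (n r : ℕ) [NeZero r] (κ c ε : ℝ), 0 < κ → 0 < c → 0 < ε →
        ∃ (a : ℕ) (circ : Procrustes.Circuit r n a),
          (∀ q : Procrustes.Query,
            (Procrustes.Circuit.uses q circ : ℝ) ≤
              C * ((r : ℝ) ^ 2 * κ ^ 2 / (c ^ (3 / 2 : ℝ) * ε ^ 3)) *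
                Real.log (2 + r * κ / (c * ε)) ^ k) ∧
          ∀ (ψ φ : Fin r → Procrustes.Vec (Fin (2 ^ n)))
            (Uψ Uφ : Matrix.unitaryGroup (Fin r × Fin (2 ^ n)) ℂ)
            (Uin : Matrix.unitaryGroup (Fin (2 ^ n)) ℂ)
            (x : Procrustes.Vec (Fin (2 ^ n)))
            (S : Procrustes.SVD (Procrustes.procrustesMatrix ψ φ)),
            Procrustes.IsStatePreparation Uψ ψ →
            Procrustes.IsStatePreparation Uφ φ →
            Procrustes.act (Uin : Matrix (Fin (2 ^ n)) (Fin (2 ^ n)) ℂ) (Procrustes.ket 0) = x →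
            S.row = Submodule.span ℂ (Set.range ψ) →
            1 / S.sigmaMin ≤ κ →
            c < Procrustes.overlap ψ x →
            ‖circ.output Uψ Uφ Uin - Procrustes.padded a (Procrustes.idealState S x)‖ ≤ ε := by
  refine ⟨40000000, 2, by norm_num, fun n r _ κ c ε hκ hc hε => ?_⟩
  by_cases hpar : 1 ≤ r * κ ∧ c ≤ 1 ∧ ε ≤ 2
  · obtain ⟨hR, hc1, hε2⟩ := hpar
    exact Procrustes.exists_circuit_uses_le n hκ hc hε hR hc1 hε2
  · exact Procrustes.exists_circuit_of_trivial n hκ hc hε hpar
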